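/- Let $G$ be a locally compact (Hausdorff) group with a left Haar measure $m$, and let $1<p<\infty$. Regard $A=L^1(G)$ as a Banach algebra under convolution and $L^p(G)$ as a Banach left $A$-module under $f\cdot g=f\star g$, where $(f\star g)(s)=\int_G f(t)\,g(t^{-1}s)\,dm(t)$. Suppose that $L^p(G)$ is injective, that is: for all Banach left $A$-modules $E,F$, every bounded $A$-module morphism $T:E\to F$ that has a bounded linear left inverse, and every bounded $A$-module morphism $S:E\to L^p(G)$, there is a bounded $A$-module morphism $R:F\to L^p(G)$ with $R\circ T=S$. Then $G$ is $(p,p)$-amenable. Here $(p,q)$-amenability, for $1\le p\le q<\infty$, is defined as follows. For a Banach space $E$ with dual $E'$, and $x=(x_1,\dots,x_n)\in E^n$, put $$\mu_{p,n}(x)=\sup\Big\{\Big(\sum_{i=1}^n|\langle x_i,\lambda\rangle|^p\Big)^{1/p}:\lambda\in E',\ \|\lambda\|\le1\Big\},$$ $$\|x\|_n^{(p,q)}=\sup\Big\{\Big(\sum_{i=1}^n|\langle x_i,\lambda_i\rangle|^q\Big)^{1/q}:\lambda=(\lambda_1,\dots,\lambda_n)\in (E')^n,\ \mu_{p,n}(\lambda)\le1\Big\}.$$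 The group $G$ acts on $L^1(G)$ by $(s\cdot f)(t)=f(s^{-1}t)$, and on $L^1(G)''$ by duality. A mean is an element $\Lambda\in L^1(G)''$ with $\langle 1,\Lambda\rangle=\|\Lambda\|=1$, where $1\in L^\infty(G)$ is the constant function, viewed as the functional $f\mapsto\int_G f\,dm$ in $L^1(G)'$. The group $G$ is $(p,q)$-amenable if there is a mean $\Lambda\in L^1(G)''$ such that $$\sup\big\{\|(s_1\cdot\Lambda,\dots,s_n\cdot\Lambda)\|_n^{(p,q)}:n\in\mathbb N,\ s_1,\dots,s_n\in G\big\}<\infty,$$ the norm being taken over $E=L^1(G)''$. -/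

import Mathlib

open MeasureTheory Filter Topology
open scoped ENNReal

noncomputable section

universe u v

/-! ### Banach modules and injectivity -/

/-- A Banach left module structure of a (complex) Banach algebra `A` on a (complex) Banach space
`E`: a jointly continuous bilinear action with `(a * b) · x = a · (b · x)`. -/
class BanachLeftModule (A : Type u) (E : Type v) [NonUnitalNormedRing A] [NormedSpace ℂ A]
    [NormedAddCommGroup E] [NormedSpace ℂ E] where
  /-- The action `(a, x) ↦ a · x`. -/
  act : A →L[ℂ] E →L[ℂ] E
  act_mul : ∀ (a b : A) (x : E), act (a * b) x = act a (act b x)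

/-- The bounded linear map `T : E → F` is a morphism of left `A`-modules. -/
def IsModuleMorphism (A : Type u) {E F : Type*} [NonUnitalNormedRing A] [NormedSpace ℂ A]
    [NormedAddCommGroup E] [NormedSpace ℂ E] [BanachLeftModule A E]
    [NormedAddCommGroup F] [NormedSpace ℂ F] [BanachLeftModule A F] (T : E →L[ℂ] F) : Prop :=
  ∀ (a : A) (x : E), T (BanachLeftModule.act a x) = BanachLeftModule.act a (T x)

/-- `T : E → F` is admissible: it has a bounded linear left inverse (in particular it is
injective). -/
def IsAdmissible {E F : Type*} [NormedAddCommGroup E] [NormedSpace ℂ E]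
    [NormedAddCommGroup F] [NormedSpace ℂ F] (T : E →L[ℂ] F) : Prop :=
  ∃ S : F →L[ℂ] E, S ∘L T = ContinuousLinearMap.id ℂ E

/-- The Banach left `A`-module `J` is injective: every morphism from `E` to `J` extends along every
admissible monomorphism of Banach left `A`-modules `T : E → F`. -/
def IsInjectiveBanachModule (A : Type u) (J : Type v) [NonUnitalNormedRing A] [NormedSpace ℂ A]
    [NormedAddCommGroup J] [NormedSpace ℂ J] [BanachLeftModule A J] : Prop :=
  ∀ (E F : Type (max u v))
    [NormedAddCommGroup E] [NormedSpace ℂ E] [CompleteSpace E] [BanachLeftModule A E]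
    [NormedAddCommGroup F] [NormedSpace ℂ F] [CompleteSpace F] [BanachLeftModule A F]
    (T : E →L[ℂ] F), IsModuleMorphism A T → IsAdmissible T →
    ∀ S : E →L[ℂ] J, IsModuleMorphism A S →
      ∃ R : F →L[ℂ] J, IsModuleMorphism A R ∧ R ∘L T = S

/-! ### The weak `(p, q)`-multi-norm -/

section MultiNorm

variable {E : Type*} [NormedAddCommGroup E] [NormedSpace ℂ E]

/-- The weak `p`-summing norm of `x = (x₁, …, xₙ) ∈ Eⁿ`:
`sup {(∑ |⟨xᵢ, φ⟩|ᵖ)^(1/p) : φ ∈ E', ‖φ‖ ≤ 1}`. -/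
def weakSummingNorm (p : ℝ) {n : ℕ} (x : Fin n → E) : ℝ≥0∞ :=
  ⨆ (φ : StrongDual ℂ E) (_ : ‖φ‖ ≤ 1), (∑ i, ‖φ (x i)‖ₑ ^ p) ^ (1 / p)

/-- The weak `(p, q)`-multi-norm of `x = (x₁, …, xₙ) ∈ Eⁿ`: the supremum of
`(∑ |⟨xᵢ, φᵢ⟩|^q)^(1/q)` over all `φ ∈ (E')ⁿ` whose weak `p`-summing norm is at most `1`. -/
def weakMultiNorm (p q : ℝ) {n : ℕ} (x : Fin n → E) : ℝ≥0∞ :=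
  ⨆ (φ : Fin n → StrongDual ℂ E) (_ : weakSummingNorm p φ ≤ 1),
    (∑ i, ‖φ i (x i)‖ₑ ^ q) ^ (1 / q)

/-- `B ⊆ E` is multi-bounded in the weak `(p, q)`-multi-norm: the multi-norms of all finite
families of elements of `B` are bounded by one finite constant. -/
def IsWeakMultiBounded (p q : ℝ) (B : Set E) : Prop :=
  (⨆ (n : ℕ) (x : Fin n → E) (_ : ∀ i, x i ∈ B), weakMultiNorm p q x) < ∞

end MultiNorm

/-! ### The group algebra and its modules `Lᵖ(G)` -/

section Group

variable {G : Type u} [Group G] [TopologicalSpace G] [IsTopologicalGroup G] [LocallyCompactSpace G]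
  [MeasurableSpace G] [BorelSpace G] (μ : Measure G) [μ.IsHaarMeasure] [μ.Regular]

instance fact_one_ne_top_ennreal : Fact ((1 : ℝ≥0∞) ≠ ∞) := ⟨ENNReal.one_ne_top⟩

/-- Left translation on `Lᵖ(G)`: `(s · f)(t) = f (s⁻¹ t)`. -/
def leftTranslation (p : ℝ≥0∞) [Fact (1 ≤ p)] (s : G) : Lp ℂ p μ →L[ℂ] Lp ℂ p μ :=
  (Lp.compMeasurePreservingₗᵢ ℂ (fun t => s⁻¹ * t)
    (measurePreserving_mul_left μ s⁻¹)).toContinuousLinearMap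

section Conv

variable (p : ℝ≥0∞) [Fact (1 ≤ p)]

theorem leftTranslation_ae (s : G) (f : Lp ℂ p μ) :
    leftTranslation μ p s f =ᵐ[μ] fun t => f (s⁻¹ * t) :=
  Lp.coeFn_compMeasurePreserving _ _

theorem norm_leftTranslation (s : G) (f : Lp ℂ p μ) : ‖leftTranslation μ p s f‖ = ‖f‖ :=
  (Lp.compMeasurePreservingₗᵢ ℂ (fun t => s⁻¹ * t)
    (measurePreserving_mul_left μ s⁻¹)).norm_map f

theorem leftTranslation_mul (s t : G) (f : Lp ℂ p μ) :
    leftTranslation μ p (s * t) f = leftTranslation μ p s (leftTranslation μ p t f) := by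
  refine Lp.ext ?_
  have h1 := leftTranslation_ae μ p (s * t) f
  have h2 := leftTranslation_ae μ p s (leftTranslation μ p t f)
  have h3 := (measurePreserving_mul_left μ s⁻¹).quasiMeasurePreserving.ae
    (leftTranslation_ae μ p t f)
  filter_upwards [h1, h2, h3] with r h1 h2 h3
  rw [h1, h2, h3, mul_inv_rev, mul_assoc]

theorem continuous_leftTranslation [Fact (p ≠ ∞)] (f : Lp ℂ p μ) :
    Continuous fun s : G => leftTranslation μ p s f := by
  have h : Continuous fun s : G => DomMulAct.mk s⁻¹ • f :=
    (DomMulAct.continuous_mk.comp continuous_inv).smul continuous_const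
  exact h

theorem aestronglyMeasurable_restrict_of_continuous {E : Type*} [NormedAddCommGroup E]
    {φ : G → E} (hφ : Continuous φ) {s : Set G} (hs : MeasurableSet s) (hμs : μ s ≠ ∞) :
    AEStronglyMeasurable φ (μ.restrict s) := by
  have key : ∀ n : ℕ, ∃ K, K ⊆ s ∧ IsCompact K ∧ IsClosed K ∧
      μ (s \ K) < ENNReal.ofReal (1 / ((n : ℝ) + 1)) := fun n =>
    hs.exists_isCompact_isClosed_sdiff_lt hμs (by simp; positivity)
  choose K hKs hKc hKcl hKμ using key
  have h0 : μ (s \ ⋃ n, K n) = 0 := by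
    refine le_antisymm (ge_of_tendsto' (x := atTop)
      (f := fun n : ℕ => ENNReal.ofReal (1 / ((n : ℝ) + 1))) ?_ fun n => ?_) zero_le
    · simpa using ENNReal.tendsto_ofReal tendsto_one_div_add_atTop_nhds_zero_nat
    · exact (measure_mono (Set.sdiff_subset_sdiff_right (Set.subset_iUnion K n))).trans (hKμ n).le
  have h1 : μ.restrict s = μ.restrict (⋃ n, K n) := by
    refine Measure.restrict_congr_set (ae_eq_set.2 ⟨h0, ?_⟩)
    rw [Set.sdiff_eq_empty.2 (Set.iUnion_subset hKs), measure_empty]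
  rw [h1, aestronglyMeasurable_iUnion_iff]
  exact fun n => hφ.continuousOn.aestronglyMeasurable_of_isCompact (hKc n) (hKcl n).measurableSet

theorem integrable_translation [Fact (p ≠ ∞)] (f : Lp ℂ 1 μ) (g : Lp ℂ p μ) :
    Integrable (fun t => f t • leftTranslation μ p t g) μ := by
  have hf : Integrable f μ := L1.integrable_coeFn f
  have hc := continuous_leftTranslation μ p g
  have hm : AEStronglyMeasurable (fun t => f t • leftTranslation μ p t g) μ := by
    obtain ⟨t, ht, h0, hσ⟩ := hf.aefinStronglyMeasurable.exists_set_sigmaFinite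
    have h1 : AEStronglyMeasurable (fun t => leftTranslation μ p t g) (μ.restrict t) := by
      have hU : t = ⋃ n, spanningSets (μ.restrict t) n ∩ t := by
        rw [← Set.iUnion_inter, iUnion_spanningSets, Set.univ_inter]
      rw [hU, aestronglyMeasurable_iUnion_iff]
      intro n
      have hms := measurableSet_spanningSets (μ.restrict t) n
      refine aestronglyMeasurable_restrict_of_continuous μ hc (hms.inter ht) ?_
      rw [← Measure.restrict_apply hms]
      exact (measure_spanningSets_lt_top _ n).ne
    have h2 : AEStronglyMeasurable (fun t => f t • leftTranslation μ p t g) (μ.restrict tᶜ) := by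
      refine (aestronglyMeasurable_const (b := (0 : Lp ℂ p μ))).congr ?_
      filter_upwards [h0] with x hx
      rw [hx, Pi.zero_apply, zero_smul]
    have h3 := aestronglyMeasurable_union_iff.2 ⟨hf.1.restrict.smul h1, h2⟩
    rwa [Set.union_compl_self, Measure.restrict_univ] at h3
  refine (hf.norm.mul_const ‖g‖).mono' hm (Eventually.of_forall fun t => ?_)
  rw [norm_smul, norm_leftTranslation]

/-- The convolution `f ⋆ g = ∫ f(t) (t · g) dm(t)` of `f ∈ L¹(G)` and `g ∈ Lᵖ(G)`, that is,
`(f ⋆ g)(s) = ∫ f(t) g(t⁻¹ s) dm(t)` for almost all `s`; the integral is a (convergent) Bochner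
integral in `Lᵖ(G)`. -/
def convolutionLp [Fact (p ≠ ∞)] : Lp ℂ 1 μ →L[ℂ] Lp ℂ p μ →L[ℂ] Lp ℂ p μ :=
  LinearMap.mkContinuous₂
    (LinearMap.mk₂ ℂ (fun (f : Lp ℂ 1 μ) (g : Lp ℂ p μ) => ∫ t, f t • leftTranslation μ p t g ∂μ)
      (fun f f' g => by
        rw [← integral_add (integrable_translation μ p f g) (integrable_translation μ p f' g)]
        refine integral_congr_ae ?_
        filter_upwards [Lp.coeFn_add f f'] with t ht
        rw [ht, Pi.add_apply, add_smul])
      (fun c f g => by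
        rw [← integral_smul]
        refine integral_congr_ae ?_
        filter_upwards [Lp.coeFn_smul c f] with t ht
        rw [ht, Pi.smul_apply, smul_assoc])
      (fun f g g' => by
        rw [← integral_add (integrable_translation μ p f g) (integrable_translation μ p f g')]
        simp only [map_add, smul_add])
      (fun c f g => by
        rw [← integral_smul]
        simp only [map_smul, smul_comm c]))
    1
    (fun f g => by
      refine (norm_integral_le_integral_norm _).trans ?_
      simp only [norm_smul, norm_leftTranslation]
      rw [integral_mul_const, one_mul, L1.norm_eq_integral_norm])

theorem convolutionLp_apply [Fact (p ≠ ∞)] (f : Lp ℂ 1 μ) (g : Lp ℂ p μ) :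
    convolutionLp μ p f g = ∫ t, f t • leftTranslation μ p t g ∂μ := rfl

theorem norm_convolutionLp_le [Fact (p ≠ ∞)] (f : Lp ℂ 1 μ) (g : Lp ℂ p μ) :
    ‖convolutionLp μ p f g‖ ≤ ‖f‖ * ‖g‖ := by
  refine (norm_integral_le_integral_norm _).trans ?_
  simp only [norm_smul, norm_leftTranslation]
  rw [integral_mul_const, L1.norm_eq_integral_norm]

theorem convolutionLp_leftTranslation [Fact (p ≠ ∞)] (s : G) (f : Lp ℂ 1 μ) (g : Lp ℂ p μ) :
    convolutionLp μ p (leftTranslation μ 1 s f) g =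
      leftTranslation μ p s (convolutionLp μ p f g) := by
  have h := ContinuousLinearMap.integral_comp_comm (leftTranslation μ p s)
    (integrable_translation μ p f g)
  rw [convolutionLp_apply, convolutionLp_apply, ← h,
    ← integral_mul_left_eq_self (fun t => leftTranslation μ 1 s f t • leftTranslation μ p t g) s]
  refine integral_congr_ae ?_
  filter_upwards [(measurePreserving_mul_left μ s).quasiMeasurePreserving.ae
    (leftTranslation_ae μ 1 s f)] with t ht
  rw [ht, inv_mul_cancel_left, leftTranslation_mul, map_smul]

theorem convolutionLp_assoc [Fact (p ≠ ∞)] (f f' : Lp ℂ 1 μ) (g : Lp ℂ p μ) :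
    convolutionLp μ p (convolutionLp μ 1 f f') g =
      convolutionLp μ p f (convolutionLp μ p f' g) := by
  have h := ContinuousLinearMap.integral_comp_comm ((convolutionLp μ p).flip g)
    (integrable_translation μ 1 f f')
  rw [convolutionLp_apply μ 1, ← ContinuousLinearMap.flip_apply (convolutionLp μ p), ← h,
    convolutionLp_apply μ p f]
  simp only [map_smul, ContinuousLinearMap.flip_apply, convolutionLp_leftTranslation]

end Conv

/-- The group algebra `L¹(G)`, with the convolution product. -/
instance groupAlgebraRing : NonUnitalNormedRing (Lp ℂ 1 μ) :=
  { (inferInstance : NormedAddCommGroup (Lp ℂ 1 μ)) with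
    mul := fun f g => convolutionLp μ 1 f g
    left_distrib := fun f g h => map_add (convolutionLp μ 1 f) g h
    right_distrib := fun f g h => (convolutionLp μ 1).map_add₂ f g h
    zero_mul := fun f => (convolutionLp μ 1).map_zero₂ f
    mul_zero := fun f => map_zero (convolutionLp μ 1 f)
    mul_assoc := fun f g h => convolutionLp_assoc μ 1 f g h
    norm_mul_le := fun f g => norm_convolutionLp_le μ 1 f g }

instance groupAlgebra_isScalarTower : IsScalarTower ℂ (Lp ℂ 1 μ) (Lp ℂ 1 μ) :=
  ⟨fun c f g => (convolutionLp μ 1).map_smul₂ c f g⟩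

instance groupAlgebra_smulCommClass : SMulCommClass ℂ (Lp ℂ 1 μ) (Lp ℂ 1 μ) :=
  ⟨fun c f g => ((convolutionLp μ 1 f).map_smul c g).symm⟩

/-- `Lᵖ(G)` is a Banach left `L¹(G)`-module under convolution. -/
instance lpBanachLeftModule (p : ℝ≥0∞) [Fact (1 ≤ p)] [Fact (p ≠ ∞)] :
    BanachLeftModule (Lp ℂ 1 μ) (Lp ℂ p μ) where
  act := convolutionLp μ p
  act_mul := convolutionLp_assoc μ p

/-! ### Means and `(p, q)`-amenability -/

/-- The action of `G` on `L¹(G)''` that extends left translation on `L¹(G)` by duality: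
`⟨λ, s · Λ⟩ = ⟨λ · s, Λ⟩`, where `⟨f, λ · s⟩ = ⟨s · f, λ⟩`. -/
def bidualTranslation (s : G) (Λ : StrongDual ℂ (StrongDual ℂ (Lp ℂ 1 μ))) :
    StrongDual ℂ (StrongDual ℂ (Lp ℂ 1 μ)) :=
  Λ ∘L ContinuousLinearMap.precomp ℂ (leftTranslation μ 1 s)

/-- The constant function `1 ∈ L^∞(G) = L¹(G)'`, that is, the functional `f ↦ ∫ f dm`. -/
def constOneFunctional : StrongDual ℂ (Lp ℂ 1 μ) :=
  LinearMap.mkContinuous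
    { toFun := fun f => ∫ t, f t ∂μ
      map_add' := fun f g => by
        rw [← integral_add (L1.integrable_coeFn f) (L1.integrable_coeFn g)]
        exact integral_congr_ae (Lp.coeFn_add f g)
      map_smul' := fun c f => by
        rw [RingHom.id_apply, ← integral_smul]
        exact integral_congr_ae (Lp.coeFn_smul c f) }
    1
    (fun f => by
      rw [one_mul, L1.norm_eq_integral_norm]
      exact norm_integral_le_integral_norm _)

/-- `Λ ∈ L¹(G)''` is a mean: `⟨1, Λ⟩ = ‖Λ‖ = 1`. -/
def IsMean (Λ : StrongDual ℂ (StrongDual ℂ (Lp ℂ 1 μ))) : Prop :=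
  Λ (constOneFunctional μ) = 1 ∧ ‖Λ‖ = 1

/-- `Λ` is a left `(p, q)`-multi-invariant mean: a mean whose orbit `{s · Λ : s ∈ G}` is
multi-bounded in the weak `(p, q)`-multi-norm over `L¹(G)''`. -/
def IsLeftMultiInvariantMean (p q : ℝ) (Λ : StrongDual ℂ (StrongDual ℂ (Lp ℂ 1 μ))) : Prop :=
  IsMean μ Λ ∧ IsWeakMultiBounded p q (Set.range fun s : G => bidualTranslation μ s Λ)

/-- `G` is `(p, q)`-amenable (for `1 ≤ p ≤ q < ∞`): there is a left `(p, q)`-multi-invariant mean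
in `L¹(G)''`. -/
def IsMultiAmenable (p q : ℝ) : Prop :=
  ∃ Λ : StrongDual ℂ (StrongDual ℂ (Lp ℂ 1 μ)), IsLeftMultiInvariantMean μ p q Λ

end Group

end

/-!
Let `J = Lᵖ(G)`, and let `F` be the space of bounded continuous functions `T : G → J`. It is a
Banach left `L¹(G)`-module under `(a · T)(t) = ∫ a(s) T(t s) dμ(s)`, the orbit embedding
`g ↦ (t ↦ t · g)` of `J` into `F` is a module morphism, and evaluation at `1` is a bounded left
inverse of it. So if `J` is injective, there is a module morphism `R : F → J` with
`R (t ↦ t · g) = g` (`exists_retraction_of_isInjective`). It satisfies `R (T(· s)) = s · R T`, because `L¹(G)` acts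
faithfully on `J` (`map_rightShift_of_isModuleMorphism`).

For a neighbourhood `V` of `1` take a unit vector `g` of `J` supported in `V`, and a functional
`ℓ` that norms `g` and sees only `V`. Put `M(φ) = ℓ (R (t ↦ φ(t⁻¹) (t · g)))` for bounded
continuous `φ : G → ℂ`. Then `M(1) = 1` and, by the equivariance of `R`,
`M(φ(s ·)) = ℓ (s⁻¹ · R (t ↦ φ(t⁻¹) (t s · g)))`. If the sets `sᵢ V` are disjoint and
`∑ |φᵢ|ᵖ ≤ 1`, the functions `t ↦ ∑ ± φᵢ(t⁻¹) (t sᵢ · g)` have norm at most `1` in `F`, and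
averaging over the signs gives `∑ |M(φᵢ(sᵢ ·))|ᵖ ≤ ‖R‖ᵖ`
(`exists_functional_of_disjoint_translates`). A weak-star limit along `V → 1` has
this property for all finite families of distinct `sᵢ` (`IsShiftSummable`), and then for families
with repetitions (`IsShiftSummable.sum_le`).

The limit `M` need not be a mean. If unit vectors `hₖ` satisfy `|M(hₖ)| → ‖M‖`, then the
functionals `φ ↦ M(hₖ φ) / M(hₖ)` have the same summability property, up to a factor `2`, and any
weak-star limit of them has norm `1` and takes the value `1` at `1`
(`IsShiftSummable.exists_norm_le_one`). Its composition with the map `x ↦ (t ↦ ⟨t · e, x⟩)` from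
`L¹(G)'` to the bounded continuous functions, where `e ≥ 0` and `∫ e = 1`, is a mean in `L¹(G)''`.

The multi-norm over `L¹(G)''` is a supremum over families in the third dual of `L¹(G)`. It is
reduced to families in `L¹(G)'` by a form of Goldstine's theorem for the weak `p`-summing norm
(`sum_norm_bidual_apply_rpow_le`), at the price of another factor `2`.
-/

open scoped BoundedContinuousFunction Pointwise

noncomputable section

universe u

/-! ### Translations of bounded continuous functions -/

section Shifts

variable {G : Type u} [Group G] [TopologicalSpace G] [IsTopologicalGroup G]
  {E : Type*} [NormedAddCommGroup E]

/-- Right translation of a bounded continuous function: `t ↦ T (t s)`. -/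
def rightShift (s : G) (T : G →ᵇ E) : G →ᵇ E :=
  T.compContinuous (ContinuousMap.mulRight s)

theorem rightShift_apply (s : G) (T : G →ᵇ E) (t : G) : rightShift s T t = T (t * s) := rfl

/-- Left translation of a bounded continuous function: `t ↦ T (s t)`. -/
def leftShift (s : G) (T : G →ᵇ E) : G →ᵇ E :=
  T.compContinuous (ContinuousMap.mulLeft s)

theorem leftShift_apply (s : G) (T : G →ᵇ E) (t : G) : leftShift s T t = T (s * t) := rfl

end Shifts

/-! ### The module of bounded continuous `Lᵖ(G)`-valued functions -/

section Module

variable {G : Type u} [Group G] [TopologicalSpace G] [IsTopologicalGroup G] [LocallyCompactSpace G]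
  [MeasurableSpace G] [BorelSpace G] (μ : Measure G) [μ.IsHaarMeasure] [μ.Regular]
  {E : Type*} [NormedAddCommGroup E] [NormedSpace ℂ E]

theorem integrable_smul_of_continuous_of_norm_le (a : Lp ℂ 1 μ) {T : G → E} (hT : Continuous T)
    {C : ℝ} (hC : ∀ t, ‖T t‖ ≤ C) : Integrable (fun t => a t • T t) μ := by
  have ha : Integrable a μ := L1.integrable_coeFn a
  have hm : AEStronglyMeasurable (fun t => a t • T t) μ := by
    -- `a` vanishes off a `σ`-finite set, and there `T` is strongly measurable piece by piece
    obtain ⟨t, ht, h0, hσ⟩ := ha.aefinStronglyMeasurable.exists_set_sigmaFinite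
    have h1 : AEStronglyMeasurable T (μ.restrict t) := by
      have hU : t = ⋃ n, spanningSets (μ.restrict t) n ∩ t := by
        rw [← Set.iUnion_inter, iUnion_spanningSets, Set.univ_inter]
      rw [hU, aestronglyMeasurable_iUnion_iff]
      intro n
      have hms := measurableSet_spanningSets (μ.restrict t) n
      refine aestronglyMeasurable_restrict_of_continuous μ hT (hms.inter ht) ?_
      rw [← Measure.restrict_apply hms]
      exact (measure_spanningSets_lt_top _ n).ne
    have h2 : AEStronglyMeasurable (fun t => a t • T t) (μ.restrict tᶜ) := by
      refine (aestronglyMeasurable_const (b := (0 : E))).congr ?_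
      filter_upwards [h0] with x hx
      rw [hx, Pi.zero_apply, zero_smul]
    have h3 := aestronglyMeasurable_union_iff.2 ⟨ha.1.restrict.smul h1, h2⟩
    rwa [Set.union_compl_self, Measure.restrict_univ] at h3
  refine (ha.norm.mul_const C).mono' hm (Eventually.of_forall fun t => ?_)
  rw [norm_smul]
  exact mul_le_mul_of_nonneg_left (hC t) (norm_nonneg _)

theorem integrable_smul_boundedContinuous (a : Lp ℂ 1 μ) (T : G →ᵇ E) :
    Integrable (fun t => a t • T t) μ :=
  integrable_smul_of_continuous_of_norm_le μ a T.continuous T.norm_coe_le_norm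

/-- The pairing `(a, T) ↦ ∫ a(s) T(s) dμ(s)` of `L¹(G)` with the bounded continuous `E`-valued
functions. -/
def integralPairing : Lp ℂ 1 μ →L[ℂ] (G →ᵇ E) →L[ℂ] E :=
  LinearMap.mkContinuous₂
    (LinearMap.mk₂ ℂ (fun (a : Lp ℂ 1 μ) (T : G →ᵇ E) => ∫ t, a t • T t ∂μ)
      (fun a b T => by
        rw [← integral_add (integrable_smul_boundedContinuous μ a T)
          (integrable_smul_boundedContinuous μ b T)]
        refine integral_congr_ae ?_
        filter_upwards [Lp.coeFn_add a b] with t ht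
        rw [ht, Pi.add_apply, add_smul])
      (fun c a T => by
        rw [← integral_smul]
        refine integral_congr_ae ?_
        filter_upwards [Lp.coeFn_smul c a] with t ht
        rw [ht, Pi.smul_apply, smul_assoc])
      (fun a S T => by
        rw [← integral_add (integrable_smul_boundedContinuous μ a S)
          (integrable_smul_boundedContinuous μ a T)]
        simp only [BoundedContinuousFunction.add_apply, smul_add])
      (fun c a T => by
        rw [← integral_smul]
        simp only [BoundedContinuousFunction.smul_apply, smul_comm c]))
    1
    (fun a T => by
      refine (norm_integral_le_integral_norm _).trans ?_
      rw [one_mul, L1.norm_eq_integral_norm, ← integral_mul_const]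
      refine integral_mono (integrable_smul_boundedContinuous μ a T).norm
        ((L1.integrable_coeFn a).norm.mul_const _) fun t => ?_
      simp only [norm_smul]
      exact mul_le_mul_of_nonneg_left (T.norm_coe_le_norm t) (norm_nonneg _))

theorem integralPairing_apply (a : Lp ℂ 1 μ) (T : G →ᵇ E) :
    integralPairing μ a T = ∫ t, a t • T t ∂μ := rfl

theorem norm_integralPairing_le (a : Lp ℂ 1 μ) (T : G →ᵇ E) :
    ‖integralPairing μ a T‖ ≤ ‖a‖ * ‖T‖ := by
  have h := (integralPairing (E := E) μ).le_opNorm₂ a T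
  have h1 : ‖integralPairing (E := E) μ‖ ≤ 1 :=
    LinearMap.mkContinuous₂_norm_le _ zero_le_one _
  refine h.trans ?_
  rw [mul_assoc]
  exact mul_le_of_le_one_left (by positivity) h1

theorem integralPairing_leftTranslation (s : G) (a : Lp ℂ 1 μ) (T : G →ᵇ E) :
    integralPairing μ (leftTranslation μ 1 s a) T = ∫ t, a t • T (s * t) ∂μ := by
  rw [integralPairing_apply,
    ← integral_mul_left_eq_self (fun t => leftTranslation μ 1 s a t • T t) s]
  refine integral_congr_ae ?_
  filter_upwards [(measurePreserving_mul_left μ s).quasiMeasurePreserving.ae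
    (leftTranslation_ae μ 1 s a)] with t ht
  rw [ht, inv_mul_cancel_left]

/-- The action of `a ∈ L¹(G)` on a bounded continuous function `T : G → E`:
`(a · T)(t) = ∫ a(s) T(t s) dμ(s)`, written as the pairing of the translate `t · a` with `T`. -/
def boundedContinuousAct : Lp ℂ 1 μ →L[ℂ] (G →ᵇ E) →L[ℂ] (G →ᵇ E) :=
  LinearMap.mkContinuous₂
    (LinearMap.mk₂ ℂ (fun (a : Lp ℂ 1 μ) (T : G →ᵇ E) =>
      BoundedContinuousFunction.ofNormedAddCommGroup
        (fun t => integralPairing μ (leftTranslation μ 1 t a) T)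
        (((integralPairing (E := E) μ).flip T).continuous.comp (continuous_leftTranslation μ 1 a))
        (‖a‖ * ‖T‖)
        (fun t => (norm_integralPairing_le μ _ T).trans_eq (by rw [norm_leftTranslation])))
      (fun a b T => by ext1 t; simp; rfl)
      (fun c a T => by ext1 t; simp; rfl)
      (fun a S T => by ext1 t; simp; rfl)
      (fun c a T => by ext1 t; simp; rfl))
    1
    (fun a T => by
      rw [one_mul]
      exact (BoundedContinuousFunction.norm_le (by positivity)).2 fun t =>
        (norm_integralPairing_le μ _ T).trans_eq (by rw [norm_leftTranslation]))

theorem boundedContinuousAct_apply (a : Lp ℂ 1 μ) (T : G →ᵇ E) (t : G) :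
    boundedContinuousAct μ a T t = integralPairing μ (leftTranslation μ 1 t a) T := rfl

theorem integralPairing_convolution [CompleteSpace E] (a b : Lp ℂ 1 μ) (T : G →ᵇ E) :
    integralPairing μ (convolutionLp μ 1 a b) T =
      integralPairing μ a (boundedContinuousAct μ b T) := by
  have h := ContinuousLinearMap.integral_comp_comm ((integralPairing μ).flip T)
    (integrable_translation μ 1 a b)
  rw [convolutionLp_apply, integralPairing_apply]
  refine h.symm.trans ?_
  simp only [map_smul, ContinuousLinearMap.flip_apply]
  rfl

/-- The bounded continuous functions `G → E` form a Banach left `L¹(G)`-module. -/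
instance boundedContinuousBanachLeftModule [CompleteSpace E] :
    BanachLeftModule (Lp ℂ 1 μ) (G →ᵇ E) where
  act := boundedContinuousAct μ
  act_mul a b T := by
    ext t
    change integralPairing μ (leftTranslation μ 1 t (convolutionLp μ 1 a b)) T = _
    rw [← convolutionLp_leftTranslation, integralPairing_convolution]
    rfl

variable (p : ℝ≥0∞) [Fact (1 ≤ p)] [Fact (p ≠ ∞)]

/-- The map `φ ↦ (t ↦ φ(t⁻¹) (t · g))` from the bounded continuous functions into the bounded
continuous `Lᵖ(G)`-valued functions. -/
def orbitFunction (g : Lp ℂ p μ) : (G →ᵇ ℂ) →L[ℂ] (G →ᵇ Lp ℂ p μ) :=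
  LinearMap.mkContinuous
    { toFun := fun φ => BoundedContinuousFunction.ofNormedAddCommGroup
        (fun t => φ t⁻¹ • leftTranslation μ p t g)
        ((φ.continuous.comp continuous_inv).smul (continuous_leftTranslation μ p g))
        (‖g‖ * ‖φ‖)
        (fun t => by
          rw [norm_smul, norm_leftTranslation, mul_comm]
          exact mul_le_mul_of_nonneg_left (φ.norm_coe_le_norm _) (norm_nonneg _))
      map_add' := fun φ ψ => by ext1 t; simp [add_smul]
      map_smul' := fun c φ => by ext1 t; simp [mul_smul] }
    ‖g‖
    (fun φ => (BoundedContinuousFunction.norm_le (by positivity)).2 fun t => by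
      change ‖φ t⁻¹ • leftTranslation μ p t g‖ ≤ _
      rw [norm_smul, norm_leftTranslation, mul_comm]
      exact mul_le_mul_of_nonneg_left (φ.norm_coe_le_norm _) (norm_nonneg _))

theorem orbitFunction_apply (g : Lp ℂ p μ) (φ : G →ᵇ ℂ) (t : G) :
    orbitFunction μ p g φ t = φ t⁻¹ • leftTranslation μ p t g := rfl

theorem norm_orbitFunction_le (g : Lp ℂ p μ) : ‖orbitFunction μ p g‖ ≤ ‖g‖ :=
  LinearMap.mkContinuous_norm_le _ (norm_nonneg g) _

/-- The embedding of `Lᵖ(G)` into the bounded continuous `Lᵖ(G)`-valued functions that sends `g` to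
its orbit map `t ↦ t · g`. -/
def orbitEmbedding : Lp ℂ p μ →L[ℂ] (G →ᵇ Lp ℂ p μ) :=
  LinearMap.mkContinuous
    { toFun := fun g => orbitFunction μ p g 1
      map_add' := fun g h => by ext1 t; simp [orbitFunction_apply]
      map_smul' := fun c g => by ext1 t; simp [orbitFunction_apply] }
    1
    (fun g => by
      rw [one_mul]
      refine (BoundedContinuousFunction.norm_le (norm_nonneg g)).2 fun t => ?_
      simp [orbitFunction_apply, norm_leftTranslation])

theorem orbitEmbedding_apply (g : Lp ℂ p μ) (t : G) :
    orbitEmbedding μ p g t = leftTranslation μ p t g := by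
  change orbitFunction μ p g 1 t = _
  simp [orbitFunction_apply]

theorem isModuleMorphism_orbitEmbedding :
    IsModuleMorphism (Lp ℂ 1 μ) (orbitEmbedding μ p) := by
  intro a g
  ext1 t
  change orbitEmbedding μ p (convolutionLp μ p a g) t =
    integralPairing μ (leftTranslation μ 1 t a) (orbitEmbedding μ p g)
  rw [orbitEmbedding_apply, ← convolutionLp_leftTranslation, convolutionLp_apply,
    integralPairing_apply]
  simp only [orbitEmbedding_apply]
  rfl

theorem isAdmissible_orbitEmbedding : IsAdmissible (orbitEmbedding μ p) := by
  refine ⟨BoundedContinuousFunction.evalCLM ℂ (1 : G), ?_⟩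
  refine ContinuousLinearMap.ext fun g => ?_
  change orbitEmbedding μ p g 1 = g
  rw [orbitEmbedding_apply]
  refine Lp.ext ?_
  filter_upwards [leftTranslation_ae μ p 1 g] with t ht
  rw [ht, inv_one, one_mul]

/-- Injectivity yields a module retraction of the orbit embedding. -/
theorem exists_retraction_of_isInjective (h : IsInjectiveBanachModule (Lp ℂ 1 μ) (Lp ℂ p μ)) :
    ∃ R : (G →ᵇ Lp ℂ p μ) →L[ℂ] Lp ℂ p μ, IsModuleMorphism (Lp ℂ 1 μ) R ∧
      ∀ g, R (orbitEmbedding μ p g) = g := by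
  obtain ⟨R, hR, hRT⟩ := h (Lp ℂ p μ) (G →ᵇ Lp ℂ p μ) (orbitEmbedding μ p)
    (isModuleMorphism_orbitEmbedding μ p) (isAdmissible_orbitEmbedding μ p)
    (ContinuousLinearMap.id ℂ _) (fun _ _ => rfl)
  exact ⟨R, hR, fun g => DFunLike.congr_fun hRT g⟩

/-- Right translation on the level of `L¹(G)`: the element `b` is the convolution of `a` with the
point mass at `s`, that is, `b(t) = Δ(s)⁻¹ a(t s⁻¹)` with the modular function `Δ`. -/
theorem exists_integral_smul_mul_right (s : G) (a : Lp ℂ 1 μ) :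
    ∃ b : Lp ℂ 1 μ, ∀ (E : Type u) [NormedAddCommGroup E] [NormedSpace ℂ E] (T : G →ᵇ E),
      ∫ t, b t • T t ∂μ = ∫ t, a t • T (t * s) ∂μ := by
  -- right translation multiplies the Haar measure by a positive constant `c`
  have hreg : (μ.map (· * s)).Regular := Measure.Regular.map (Homeomorph.mulRight s)
  obtain ⟨c, hc0, hc⟩ : ∃ c : NNReal, c ≠ 0 ∧ μ.map (· * s) = c • μ := by
    refine ⟨_, ?_, Measure.isMulLeftInvariant_eq_smul_of_regular (μ.map (· * s)) μ⟩
    exact (Measure.haarScalarFactor_pos_of_isHaarMeasure _ _).ne'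
  have hmeas : MeasurableEmbedding (fun t : G => t * s) :=
    (Homeomorph.mulRight s).measurableEmbedding
  have hint : Integrable (fun t => a (t * s⁻¹)) (μ.map (· * s)) := by
    rw [hmeas.integrable_map_iff]
    simpa [Function.comp_def] using L1.integrable_coeFn a
  have hint' : Integrable (fun t => (c : ℂ) * a (t * s⁻¹)) μ := by
    rw [hc] at hint
    refine Integrable.const_mul ?_ _
    exact (integrable_smul_measure (c := (c : ℝ≥0∞)) (by simpa using hc0) (by simp)).1 hint
  refine ⟨hint'.toL1 _, fun E _ _ T => ?_⟩
  have h1 : ∫ t, a t • T (t * s) ∂μ = ∫ t, a (t * s⁻¹) • T t ∂(μ.map (· * s)) := by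
    rw [hmeas.integral_map]
    simp
  rw [h1, hc, integral_smul_nnreal_measure]
  rw [NNReal.smul_def, ← integral_smul]
  refine integral_congr_ae ?_
  filter_upwards [hint'.coeFn_toL1] with t ht
  rw [ht, mul_smul]
  exact Complex.coe_smul (c : ℝ) _

/-- The elements of `Lᵖ(G)` are separated by the action of `L¹(G)`: a nonzero `z` is moved to a
nonzero vector by the indicator of a small neighbourhood of `1`, where `t · z` is close to `z`. -/
theorem eq_of_convolutionLp_eq {x y : Lp ℂ p μ}
    (h : ∀ a, convolutionLp μ p a x = convolutionLp μ p a y) : x = y := by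
  rw [← sub_eq_zero]
  set z := x - y with hz
  have hz0 : ∀ a, convolutionLp μ p a z = 0 := fun a => by rw [hz, map_sub, h, sub_self]
  by_contra hne
  have hpos : 0 < ‖z‖ := norm_pos_iff.2 hne
  obtain ⟨K, hK, hK1⟩ := exists_compact_mem_nhds (1 : G)
  have hcont := continuous_leftTranslation μ p z
  have h1 : leftTranslation μ p 1 z = z := by
    refine Lp.ext ?_
    filter_upwards [leftTranslation_ae μ p 1 z] with t ht
    rw [ht, inv_one, one_mul]
  have hU : {t : G | ‖leftTranslation μ p t z - z‖ < ‖z‖ / 2} ∈ 𝓝 (1 : G) := by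
    refine (hcont.sub continuous_const).norm.continuousAt.eventually_lt
      continuousAt_const ?_
    change ‖leftTranslation μ p 1 z - z‖ < _
    rw [h1, sub_self, norm_zero]
    positivity
  obtain ⟨V, hVsub, hV, hV1⟩ := mem_nhds_iff.1 (inter_mem hK1 hU)
  have hVfin : μ V ≠ ∞ := ((measure_mono fun t ht => (hVsub ht).1).trans_lt hK.measure_lt_top).ne
  have hVpos : 0 < μ.real V := by
    rw [measureReal_def]
    exact ENNReal.toReal_pos (hV.measure_pos μ ⟨1, hV1⟩).ne' hVfin
  have hbound : ∀ t, ‖leftTranslation μ p t z - z‖ ≤ ‖z‖ + ‖z‖ := fun t =>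
    (norm_sub_le _ _).trans (by rw [norm_leftTranslation])
  set a : Lp ℂ 1 μ := indicatorConstLp 1 hV.measurableSet hVfin (1 : ℂ) with ha
  have haV : a =ᵐ[μ] V.indicator fun _ => (1 : ℂ) := indicatorConstLp_coeFn
  have hi1 := integrable_translation μ p a z
  have hi2 : Integrable (fun t => a t • z) μ := (L1.integrable_coeFn a).smul_const z
  have e1 : ∫ t, a t • (leftTranslation μ p t z - z) ∂μ = -((μ.real V : ℂ) • z) := by
    simp only [smul_sub]
    rw [integral_sub hi1 hi2, ← convolutionLp_apply, hz0, zero_sub, integral_smul_const]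
    congr 2
    rw [integral_congr_ae haV, integral_indicator hV.measurableSet]
    simp
  have e2 : ‖∫ t, a t • (leftTranslation μ p t z - z) ∂μ‖ ≤ μ.real V * (‖z‖ / 2) := by
    refine (norm_integral_le_of_norm_le
      (g := V.indicator fun _ => ‖z‖ / 2) ?_ ?_).trans_eq ?_
    · exact (integrable_indicator_iff hV.measurableSet).2 (integrableOn_const hVfin)
    · filter_upwards [haV] with t ht
      by_cases htV : t ∈ V
      · rw [ht, Set.indicator_of_mem htV, Set.indicator_of_mem htV, one_smul]
        exact (hVsub htV).2.le
      · rw [ht, Set.indicator_of_notMem htV, Set.indicator_of_notMem htV, zero_smul, norm_zero]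
    · rw [integral_indicator hV.measurableSet]
      simp
  rw [e1, norm_neg, norm_smul, Complex.norm_real, Real.norm_of_nonneg hVpos.le] at e2
  nlinarith [mul_pos hVpos hpos]

/-- A module morphism into `Lᵖ(G)` intertwines right translation of functions with left translation
on `Lᵖ(G)`. -/
theorem map_rightShift_of_isModuleMorphism {R : (G →ᵇ Lp ℂ p μ) →L[ℂ] Lp ℂ p μ}
    (hR : IsModuleMorphism (Lp ℂ 1 μ) R) (s : G) (T : G →ᵇ Lp ℂ p μ) :
    R (rightShift s T) = leftTranslation μ p s (R T) := by
  refine eq_of_convolutionLp_eq μ p fun a => ?_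
  obtain ⟨b, hb⟩ := exists_integral_smul_mul_right μ s a
  have h1 : boundedContinuousAct μ a (rightShift s T) = boundedContinuousAct μ b T := by
    ext1 t
    rw [boundedContinuousAct_apply, boundedContinuousAct_apply, integralPairing_leftTranslation,
      integralPairing_leftTranslation]
    have := hb _ (leftShift t T)
    simp only [leftShift_apply] at this
    simp only [rightShift_apply, this, mul_assoc]
  have h2 : convolutionLp μ p b (R T) =
      convolutionLp μ p a (leftTranslation μ p s (R T)) := by
    rw [convolutionLp_apply, convolutionLp_apply]
    have := hb _ (orbitEmbedding μ p (R T))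
    simp only [orbitEmbedding_apply, leftTranslation_mul] at this
    exact this
  have h3 : R (boundedContinuousAct μ a (rightShift s T)) = convolutionLp μ p a _ :=
    hR a (rightShift s T)
  have h4 : R (boundedContinuousAct μ b T) = convolutionLp μ p b (R T) := hR b T
  rw [← h3, h1, h4, h2]

end Module

/-! ### Averages over signs -/

section Signs

theorem sum_intUnits_mul_apply {ι : Type*} [Fintype ι] [DecidableEq ι] {i j : ι} (h : i ≠ j) :
    ∑ ε : ι → ℤˣ, (((ε i * ε j : ℤˣ) : ℤ) : ℂ) = 0 := by
  -- flipping the sign at `j` changes the sign of the sum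
  have h1 := Fintype.sum_equiv (Equiv.mulLeft (Pi.mulSingle j (-1) : ι → ℤˣ))
    (fun ε : ι → ℤˣ => -(((ε i * ε j : ℤˣ) : ℤ) : ℂ)) (fun ε => (((ε i * ε j : ℤˣ) : ℤ) : ℂ))
    (fun ε => by simp [Pi.mulSingle_eq_of_ne h])
  rw [Finset.sum_neg_distrib] at h1
  linear_combination -(1 / 2 : ℂ) * h1

/-- The diagonal of a matrix is an average, over all changes of signs of the columns, of
row sums; hence its `ℓ^q`-norm is at most the largest of the `ℓ^q`-norms of those row sums. -/
theorem sum_norm_diag_rpow_le_of_signs {ι : Type*} [Fintype ι] {q : ℝ} (hq : 1 ≤ q)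
    (a : ι → ι → ℂ) {C : ℝ}
    (h : ∀ ε : ι → ℤˣ, ∑ i, ‖∑ j, ((ε j : ℤ) : ℂ) * a i j‖ ^ q ≤ C) :
    ∑ i, ‖a i i‖ ^ q ≤ C := by
  classical
  set N : ℕ := Fintype.card (ι → ℤˣ) with hN
  have hN0 : (0 : ℝ) < N := by exact_mod_cast Fintype.card_pos
  have hw : ∑ _ε : ι → ℤˣ, (N : ℝ)⁻¹ = 1 := by
    rw [Finset.sum_const, Finset.card_univ, ← hN, nsmul_eq_mul, mul_inv_cancel₀ hN0.ne']
  have key : ∀ i, (N : ℂ) * a i i =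
      ∑ ε : ι → ℤˣ, ((ε i : ℤ) : ℂ) * ∑ j, ((ε j : ℤ) : ℂ) * a i j := by
    intro i
    have e1 : ∀ ε : ι → ℤˣ, ((ε i : ℤ) : ℂ) * ∑ j, ((ε j : ℤ) : ℂ) * a i j =
        ∑ j, (((ε i * ε j : ℤˣ) : ℤ) : ℂ) * a i j := fun ε => by
      rw [Finset.mul_sum]
      refine Finset.sum_congr rfl fun j _ => ?_
      push_cast
      ring
    simp only [e1]
    rw [Finset.sum_comm]
    simp only [← Finset.sum_mul]
    rw [Finset.sum_eq_single i]
    · simp [hN]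
    · intro j _ hj
      rw [sum_intUnits_mul_apply hj.symm, zero_mul]
    · simp
  have hle : ∀ i, ‖a i i‖ ^ q ≤
      ∑ ε : ι → ℤˣ, (N : ℝ)⁻¹ * ‖∑ j, ((ε j : ℤ) : ℂ) * a i j‖ ^ q := by
    intro i
    have h1 : ‖a i i‖ ≤ ∑ ε : ι → ℤˣ, (N : ℝ)⁻¹ * ‖∑ j, ((ε j : ℤ) : ℂ) * a i j‖ := by
      rw [← Finset.mul_sum, ← div_eq_inv_mul, le_div_iff₀ hN0]
      have h2 := congrArg norm (key i)
      rw [norm_mul, Complex.norm_natCast, mul_comm] at h2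
      rw [h2]
      refine (norm_sum_le _ _).trans (Finset.sum_le_sum fun ε _ => ?_)
      rw [norm_mul]
      rcases Int.units_eq_one_or (ε i) with h | h <;> simp [h]
    refine (Real.rpow_le_rpow (norm_nonneg _) h1 (by linarith)).trans ?_
    exact Real.rpow_arith_mean_le_arith_mean_rpow _ _ _ (fun _ _ => by positivity) hw
      (fun _ _ => norm_nonneg _) hq
  calc ∑ i, ‖a i i‖ ^ q
      ≤ ∑ i, ∑ ε : ι → ℤˣ, (N : ℝ)⁻¹ * ‖∑ j, ((ε j : ℤ) : ℂ) * a i j‖ ^ q :=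
        Finset.sum_le_sum fun i _ => hle i
    _ = ∑ ε : ι → ℤˣ, (N : ℝ)⁻¹ * ∑ i, ‖∑ j, ((ε j : ℤ) : ℂ) * a i j‖ ^ q := by
        rw [Finset.sum_comm]
        simp only [Finset.mul_sum]
    _ ≤ ∑ _ε : ι → ℤˣ, (N : ℝ)⁻¹ * C :=
        Finset.sum_le_sum fun ε _ => mul_le_mul_of_nonneg_left (h ε) (by positivity)
    _ = C := by rw [← Finset.sum_mul, hw, one_mul]

end Signs

/-! ### Functions with disjoint supports in `Lᵖ` -/

section Exponents

theorem toReal_pos_of_fact (p : ℝ≥0∞) [h1 : Fact (1 ≤ p)] [h2 : Fact (p ≠ ∞)] : 0 < p.toReal :=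
  ENNReal.toReal_pos (zero_lt_one.trans_le h1.out).ne' h2.out

theorem one_le_toReal_of_fact (p : ℝ≥0∞) [h1 : Fact (1 ≤ p)] [h2 : Fact (p ≠ ∞)] :
    1 ≤ p.toReal := by
  simpa using ENNReal.toReal_mono h2.out h1.out

theorem sum_rpow_le_of_sum_enorm_rpow_le {ι : Type*} [Fintype ι] {E F : Type*}
    [NormedAddCommGroup E] [NormedAddCommGroup F] {q : ℝ} (hq : 0 ≤ q) {x : ι → E} {y : F}
    (h : ∑ i, ‖x i‖ₑ ^ q ≤ ‖y‖ₑ ^ q) : ∑ i, ‖x i‖ ^ q ≤ ‖y‖ ^ q := by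
  simp only [← ofReal_norm, ENNReal.ofReal_rpow_of_nonneg (norm_nonneg _) hq] at h
  rw [← ENNReal.ofReal_sum_of_nonneg fun i _ => by positivity] at h
  exact (ENNReal.ofReal_le_ofReal_iff (by positivity)).1 h

end Exponents

section Disjoint

variable {α : Type*} [MeasurableSpace α] {ν : Measure α} {p : ℝ≥0∞} [Fact (1 ≤ p)] [Fact (p ≠ ∞)]

theorem enorm_rpow_eq_lintegral (y : Lp ℂ p ν) :
    ‖y‖ₑ ^ p.toReal = ∫⁻ t, ‖y t‖ₑ ^ p.toReal ∂ν := by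
  have h := toReal_pos_of_fact p
  rw [Lp.enorm_def, eLpNorm_eq_lintegral_rpow_enorm_toReal
    (zero_lt_one.trans_le (Fact.out : 1 ≤ p)).ne' Fact.out, ← ENNReal.rpow_mul,
    one_div, inv_mul_cancel₀ h.ne', ENNReal.rpow_one]

theorem enorm_sum_rpow_le_of_disjoint {ι : Type*} [Fintype ι] (y : ι → Lp ℂ p ν) {W : ι → Set α}
    (hW : Pairwise fun i j => Disjoint (W i) (W j)) (hy : ∀ i, ∀ᵐ t ∂ν, t ∉ W i → y i t = 0) :
    ‖∑ i, y i‖ₑ ^ p.toReal ≤ ∑ i, ‖y i‖ₑ ^ p.toReal := by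
  have hp := toReal_pos_of_fact p
  simp only [enorm_rpow_eq_lintegral]
  rw [← lintegral_finsetSum' _ fun i _ =>
    (Lp.aestronglyMeasurable (y i)).enorm.pow_const _]
  refine lintegral_mono_ae ?_
  filter_upwards [Lp.coeFn_finsetSum Finset.univ y, ae_all_iff.2 hy] with t ht hyt
  rw [ht, Finset.sum_apply]
  by_cases hex : ∃ i, t ∈ W i
  · obtain ⟨i, hi⟩ := hex
    rw [Finset.sum_eq_single i (fun j _ hj => hyt j fun hjt =>
      Set.disjoint_left.1 (hW hj) hjt hi) (by simp)]
    exact Finset.single_le_sum (f := fun i => ‖y i t‖ₑ ^ p.toReal) (fun _ _ => zero_le)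
      (Finset.mem_univ i)
  · rw [Finset.sum_eq_zero fun i _ => hyt i fun h => hex ⟨i, h⟩, enorm_zero,
      ENNReal.zero_rpow_of_pos hp]
    exact zero_le

end Disjoint

/-! ### Functionals localized near the identity -/

section Group

variable {G : Type u} [Group G] [TopologicalSpace G] [IsTopologicalGroup G] [LocallyCompactSpace G]
  [MeasurableSpace G] [BorelSpace G] (μ : Measure G) [μ.IsHaarMeasure] [μ.Regular]
  (p : ℝ≥0∞) [Fact (1 ≤ p)] [Fact (p ≠ ∞)]

theorem norm_sum_smul_leftTranslation_le {ι : Type*} [Fintype ι] {V : Set G} {s : ι → G}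
    (hs : Pairwise fun i j => Disjoint (s i • V) (s j • V)) {g : Lp ℂ p μ}
    (hg : ∀ᵐ t ∂μ, t ∉ V → g t = 0) (hg1 : ‖g‖ ≤ 1) {c : ι → ℂ}
    (hc : ∑ i, ‖c i‖ ^ p.toReal ≤ 1) :
    ‖∑ i, c i • leftTranslation μ p (s i) g‖ ≤ 1 := by
  have hp := toReal_pos_of_fact p
  have h := enorm_sum_rpow_le_of_disjoint (fun i => c i • leftTranslation μ p (s i) g) hs
    (fun i => by
      filter_upwards [Lp.coeFn_smul (c i) (leftTranslation μ p (s i) g),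
        leftTranslation_ae μ p (s i) g,
        (measurePreserving_mul_left μ (s i)⁻¹).quasiMeasurePreserving.ae hg] with t h1 h2 h3 ht
      rw [h1, Pi.smul_apply, h2, h3 fun h => ht (Set.mem_smul_set_iff_inv_smul_mem.2 h),
        smul_zero])
  simp only [← ofReal_norm, ENNReal.ofReal_rpow_of_nonneg (norm_nonneg _) hp.le] at h
  rw [← ENNReal.ofReal_sum_of_nonneg fun i _ => by positivity,
    ENNReal.ofReal_le_ofReal_iff (by positivity)] at h
  have h2 : ∑ i, ‖c i • leftTranslation μ p (s i) g‖ ^ p.toReal ≤ 1 := by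
    refine (Finset.sum_le_sum fun i _ => ?_).trans hc
    refine Real.rpow_le_rpow (norm_nonneg _) ?_ hp.le
    rw [norm_smul, norm_leftTranslation]
    exact mul_le_of_le_one_right (norm_nonneg _) hg1
  have h3 := h.trans h2
  exact le_of_not_gt fun hlt => (Real.one_lt_rpow hlt hp).not_ge h3

theorem sum_enorm_restrict_leftTranslation_le {ι : Type*} [Fintype ι] {V : Set G}
    (hV : MeasurableSet V) {s : ι → G}
    (hs : Pairwise fun i j => Disjoint (s i • V) (s j • V)) (y : Lp ℂ p μ) :
    ∑ i, ‖LpToLpRestrictCLM G ℂ ℂ μ p V (leftTranslation μ p (s i)⁻¹ y)‖ₑ ^ p.toReal ≤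
      ‖y‖ₑ ^ p.toReal := by
  have hsV : ∀ i, MeasurableSet (s i • V) := fun i => hV.const_smul (s i)
  have h1 : ∀ i, ‖LpToLpRestrictCLM G ℂ ℂ μ p V (leftTranslation μ p (s i)⁻¹ y)‖ₑ ^ p.toReal =
      ∫⁻ t in s i • V, ‖y t‖ₑ ^ p.toReal ∂μ := by
    intro i
    have e1 : ∀ᵐ t ∂μ.restrict V,
        ‖LpToLpRestrictCLM G ℂ ℂ μ p V (leftTranslation μ p (s i)⁻¹ y) t‖ₑ ^ p.toReal =
          ‖y (s i * t)‖ₑ ^ p.toReal := by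
      filter_upwards [LpToLpRestrictCLM_coeFn ℂ V (leftTranslation μ p (s i)⁻¹ y),
        ae_restrict_of_ae (leftTranslation_ae μ p (s i)⁻¹ y)] with t h1 h2
      rw [h1, h2, inv_inv]
    rw [enorm_rpow_eq_lintegral, lintegral_congr_ae e1, ← lintegral_indicator hV,
      ← lintegral_indicator (hsV i),
      ← lintegral_mul_left_eq_self ((s i • V).indicator fun t => ‖y t‖ₑ ^ p.toReal) (s i)]
    refine lintegral_congr fun t => ?_
    have : s i * t ∈ s i • V ↔ t ∈ V := Set.smul_mem_smul_set_iff
    by_cases ht : t ∈ V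
    · rw [Set.indicator_of_mem ht, Set.indicator_of_mem (this.2 ht)]
    · rw [Set.indicator_of_notMem ht, Set.indicator_of_notMem (mt this.1 ht)]
  simp only [h1]
  rw [← lintegral_biUnion_finset (fun i _ j _ hij => hs hij) (fun i _ => hsV i),
    enorm_rpow_eq_lintegral]
  exact setLIntegral_le_lintegral _ _

/-- For every open neighbourhood `V` of `1` there are a unit vector `g` of `Lᵖ(G)` supported in `V`
and a functional `ℓ`, depending only on restrictions to `V`, that norms `g`. The values of `ℓ` on
disjoint translates of a function are `p`-summable with norm at most that of the function. -/
theorem exists_localized_pair {V : Set G} (hV : IsOpen V) (h1 : (1 : G) ∈ V) :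
    ∃ (g : Lp ℂ p μ) (ℓ : StrongDual ℂ (Lp ℂ p μ)), ‖g‖ ≤ 1 ∧ ‖ℓ‖ ≤ 1 ∧ ℓ g = 1 ∧
      (∀ᵐ t ∂μ, t ∉ V → g t = 0) ∧
      ∀ (ι : Type u) [Fintype ι] (s : ι → G),
        (Pairwise fun i j => Disjoint (s i • V) (s j • V)) → ∀ y : Lp ℂ p μ,
          ∑ i, ‖ℓ (leftTranslation μ p (s i)⁻¹ y)‖ ^ p.toReal ≤ ‖y‖ ^ p.toReal := by
  have hp := toReal_pos_of_fact p
  obtain ⟨K, hK, hK1⟩ := exists_compact_mem_nhds (1 : G)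
  obtain ⟨W, hWsub, hW, hW1⟩ := mem_nhds_iff.1 (inter_mem hK1 (hV.mem_nhds h1))
  have hWfin : μ W ≠ ∞ := ((measure_mono fun t ht => (hWsub ht).1).trans_lt hK.measure_lt_top).ne
  have hWpos : μ W ≠ 0 := (hW.measure_pos μ ⟨1, hW1⟩).ne'
  set g₀ : Lp ℂ p μ := indicatorConstLp p hW.measurableSet hWfin (1 : ℂ) with hg₀
  have hg₀pos : 0 < ‖g₀‖ := by
    rw [hg₀, norm_indicatorConstLp (zero_lt_one.trans_le (Fact.out : 1 ≤ p)).ne' Fact.out,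
      norm_one, one_mul, measureReal_def]
    exact Real.rpow_pos_of_pos (ENNReal.toReal_pos hWpos hWfin) _
  have hg₀V : ∀ᵐ t ∂μ, t ∉ V → g₀ t = 0 := by
    have h : ⇑g₀ =ᵐ[μ] W.indicator fun _ => (1 : ℂ) := indicatorConstLp_coeFn
    filter_upwards [h] with t ht htV
    rw [ht, Set.indicator_of_notMem fun h => htV (hWsub h).2]
  have hnorm : ‖LpToLpRestrictCLM G ℂ ℂ μ p V g₀‖ = ‖g₀‖ := by
    have e : ‖LpToLpRestrictCLM G ℂ ℂ μ p V g₀‖ₑ ^ p.toReal = ‖g₀‖ₑ ^ p.toReal := by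
      rw [enorm_rpow_eq_lintegral, enorm_rpow_eq_lintegral,
        lintegral_congr_ae (g := fun t => ‖g₀ t‖ₑ ^ p.toReal) (by
          filter_upwards [LpToLpRestrictCLM_coeFn ℂ V g₀] with t ht
          rw [ht]),
        ← lintegral_indicator hV.measurableSet]
      refine lintegral_congr_ae ?_
      filter_upwards [hg₀V] with t ht
      by_cases htV : t ∈ V
      · rw [Set.indicator_of_mem htV]
      · rw [Set.indicator_of_notMem htV, ht htV, enorm_zero, ENNReal.zero_rpow_of_pos hp]
    have e2 := congrArg ENNReal.toReal (ENNReal.rpow_left_injective hp.ne' e)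
    simpa using e2
  have hres : ∀ y : Lp ℂ p μ, ‖LpToLpRestrictCLM G ℂ ℂ μ p V y‖ ≤ ‖y‖ := norm_Lp_toLp_restrict_le V
  obtain ⟨ℓ₀, hℓ₀, hℓ₀g⟩ := exists_dual_vector'' ℂ (LpToLpRestrictCLM G ℂ ℂ μ p V g₀)
  have hle : ∀ y, ‖ℓ₀ (LpToLpRestrictCLM G ℂ ℂ μ p V y)‖ ≤ ‖LpToLpRestrictCLM G ℂ ℂ μ p V y‖ :=
    fun y => (ℓ₀.le_opNorm _).trans (mul_le_of_le_one_left (norm_nonneg _) hℓ₀)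
  refine ⟨((‖g₀‖⁻¹ : ℝ) : ℂ) • g₀, ℓ₀ ∘L LpToLpRestrictCLM G ℂ ℂ μ p V, ?_, ?_, ?_, ?_, ?_⟩
  · rw [norm_smul, Complex.norm_real, norm_inv, norm_norm, inv_mul_cancel₀ hg₀pos.ne']
  · refine ContinuousLinearMap.opNorm_le_bound _ zero_le_one fun y => ?_
    rw [one_mul]
    exact (hle y).trans (hres y)
  · rw [ContinuousLinearMap.comp_apply, map_smul, map_smul, hℓ₀g, hnorm, smul_eq_mul]
    rw [← Complex.ofReal_one, ← inv_mul_cancel₀ hg₀pos.ne', Complex.ofReal_mul]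
    rfl
  · filter_upwards [hg₀V, Lp.coeFn_smul ((‖g₀‖⁻¹ : ℝ) : ℂ) g₀] with t h2 h3 ht
    rw [h3, Pi.smul_apply, h2 ht, smul_zero]
  · intro ι _ s hs y
    refine (Finset.sum_le_sum fun i _ => ?_).trans (sum_rpow_le_of_sum_enorm_rpow_le hp.le
      (sum_enorm_restrict_leftTranslation_le μ p hV.measurableSet hs y))
    exact Real.rpow_le_rpow (norm_nonneg _) (hle _) hp.le

/-- A retraction `R` of the orbit embedding and a neighbourhood `V` of `1` give a functional `M` on
the bounded continuous functions, of norm at most `‖R‖`, with `M 1 = 1` and with the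
`(p, p)`-multi-boundedness estimate for translations that separate the translates of `V`. -/
theorem exists_functional_of_disjoint_translates {R : (G →ᵇ Lp ℂ p μ) →L[ℂ] Lp ℂ p μ}
    (hR : IsModuleMorphism (Lp ℂ 1 μ) R) (hRg : ∀ g, R (orbitEmbedding μ p g) = g)
    {V : Set G} (hV : IsOpen V) (h1 : (1 : G) ∈ V) :
    ∃ M : StrongDual ℂ (G →ᵇ ℂ), ‖M‖ ≤ ‖R‖ ∧ M 1 = 1 ∧
      ∀ (ι : Type u) [Fintype ι] (s : ι → G) (φ : ι → G →ᵇ ℂ),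
        (Pairwise fun i j => Disjoint (s i • V) (s j • V)) →
        (∀ t, ∑ i, ‖φ i t‖ ^ p.toReal ≤ 1) →
        ∑ i, ‖M (leftShift (s i) (φ i))‖ ^ p.toReal ≤ ‖R‖ ^ p.toReal := by
  have hp := toReal_pos_of_fact p
  obtain ⟨g, ℓ, hg1, hℓ1, hℓg, hgV, hℓ⟩ := exists_localized_pair μ p hV h1
  refine ⟨ℓ ∘L R ∘L orbitFunction μ p g, ?_, ?_, ?_⟩
  · calc ‖ℓ ∘L R ∘L orbitFunction μ p g‖ ≤ ‖ℓ‖ * (‖R‖ * ‖orbitFunction μ p g‖) :=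
          (ContinuousLinearMap.opNorm_comp_le _ _).trans
            (mul_le_mul_of_nonneg_left (ContinuousLinearMap.opNorm_comp_le _ _) (norm_nonneg _))
      _ ≤ 1 * (‖R‖ * 1) := by
          gcongr
          exact (norm_orbitFunction_le μ p g).trans hg1
      _ = ‖R‖ := by ring
  · change ℓ (R (orbitEmbedding μ p g)) = 1
    rw [hRg, hℓg]
  · intro ι _ s φ hs hφ
    -- equivariance moves the translation from `φᵢ` to the vector `g` and to the functional `ℓ`
    have hM : ∀ i, (ℓ ∘L R ∘L orbitFunction μ p g) (leftShift (s i) (φ i)) =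
        ℓ (leftTranslation μ p (s i)⁻¹
          (R (orbitFunction μ p (leftTranslation μ p (s i) g) (φ i)))) := by
      intro i
      rw [← map_rightShift_of_isModuleMorphism μ p hR]
      refine congrArg (fun T => ℓ (R T)) ?_
      ext1 t
      change φ i (s i * t⁻¹) • leftTranslation μ p t g =
        φ i (t * (s i)⁻¹)⁻¹ • leftTranslation μ p (t * (s i)⁻¹) (leftTranslation μ p (s i) g)
      rw [← leftTranslation_mul, mul_inv_rev, inv_inv, inv_mul_cancel_right]
    simp only [hM]
    refine sum_norm_diag_rpow_le_of_signs (one_le_toReal_of_fact p)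
      (fun i j => ℓ (leftTranslation μ p (s i)⁻¹
        (R (orbitFunction μ p (leftTranslation μ p (s j) g) (φ j))))) fun ε => ?_
    -- the sum is a sign combination of functions with disjointly supported values
    set U : G →ᵇ Lp ℂ p μ := ∑ j, ((ε j : ℤ) : ℂ) •
      orbitFunction μ p (leftTranslation μ p (s j) g) (φ j) with hU
    have hU1 : ‖U‖ ≤ 1 := by
      refine (BoundedContinuousFunction.norm_le zero_le_one).2 fun t => ?_
      have e : U t = leftTranslation μ p t
          (∑ j, (((ε j : ℤ) : ℂ) * φ j t⁻¹) • leftTranslation μ p (s j) g) := by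
        rw [hU, map_sum, BoundedContinuousFunction.sum_apply]
        refine Finset.sum_congr rfl fun j _ => ?_
        rw [BoundedContinuousFunction.smul_apply, orbitFunction_apply, map_smul, smul_smul]
      rw [e, norm_leftTranslation]
      refine norm_sum_smul_leftTranslation_le μ p hs hgV hg1 ?_
      refine le_trans (le_of_eq (Finset.sum_congr rfl fun j _ => ?_)) (hφ t⁻¹)
      rw [norm_mul]
      rcases Int.units_eq_one_or (ε j) with h | h <;> simp [h]
    have hsum : ∀ i, ∑ j, ((ε j : ℤ) : ℂ) * ℓ (leftTranslation μ p (s i)⁻¹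
        (R (orbitFunction μ p (leftTranslation μ p (s j) g) (φ j)))) =
        ℓ (leftTranslation μ p (s i)⁻¹ (R U)) := by
      intro i
      simp only [hU, map_sum, map_smul, smul_eq_mul]
    simp only [hsum]
    refine (hℓ ι s hs (R U)).trans (Real.rpow_le_rpow (norm_nonneg _) ?_ hp.le)
    exact (R.le_opNorm U).trans (mul_le_of_le_one_right (norm_nonneg _) hU1)

end Group

/-! ### Weak-star limits and norming functionals -/

section Weak

variable {X : Type*} [NormedAddCommGroup X] [NormedSpace ℂ X]

/-- The Banach–Alaoglu theorem in terms of pointwise limits along ultrafilters. -/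
theorem exists_ultrafilter_tendsto_of_norm_le {ι : Type*} (l : Filter ι) [l.NeBot]
    {M : ι → StrongDual ℂ X} {C : ℝ} (h : ∀ i, ‖M i‖ ≤ C) :
    ∃ (U : Ultrafilter ι) (N : StrongDual ℂ X), ↑U ≤ l ∧ ‖N‖ ≤ C ∧
      ∀ x, Tendsto (fun i => M i x) U (𝓝 (N x)) := by
  have hU : ↑(Ultrafilter.of l) ≤ l := Ultrafilter.of_le l
  obtain ⟨N, hN, hlim⟩ :=
    (WeakDual.isCompact_closedBall (𝕜 := ℂ) (0 : StrongDual ℂ X) C).ultrafilter_le_nhds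
    ((Ultrafilter.of l).map fun i => StrongDual.toWeakDual (M i)) (by
      rw [le_principal_iff]
      refine Filter.mem_map.2 (Filter.univ_mem' fun i => ?_)
      simpa using h i)
  refine ⟨Ultrafilter.of l, WeakDual.toStrongDual N, hU, by simpa using hN, fun x => ?_⟩
  exact ((WeakDual.eval_continuous x).tendsto N).comp hlim

end Weak

section PiLp

variable {ι : Type*} [Fintype ι] (p : ℝ≥0∞)

theorem dual_toLp_apply [DecidableEq ι] (θ : StrongDual ℂ (PiLp p fun _ : ι => ℂ)) (z : ι → ℂ) :
    θ (WithLp.toLp p z) = ∑ i, θ (WithLp.toLp p (Pi.single i 1)) * z i := by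
  have h : WithLp.toLp p z = ∑ i, z i • WithLp.toLp p (Pi.single i (1 : ℂ)) := by
    ext j
    simp [Pi.single_apply]
  rw [h, map_sum]
  refine Finset.sum_congr rfl fun i _ => ?_
  rw [map_smul, smul_eq_mul, mul_comm]

variable [Fact (1 ≤ p)] [Fact (p ≠ ∞)]

theorem norm_toLp_rpow (z : ι → ℂ) :
    ‖WithLp.toLp p z‖ ^ p.toReal = ∑ i, ‖z i‖ ^ p.toReal := by
  have hp := toReal_pos_of_fact p
  rw [PiLp.norm_eq_sum hp, ← Real.rpow_mul (by positivity), one_div, inv_mul_cancel₀ hp.ne',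
    Real.rpow_one]

theorem norm_toLp_le_iff {z : ι → ℂ} {C : ℝ} (hC : 0 ≤ C) :
    ‖WithLp.toLp p z‖ ≤ C ↔ ∑ i, ‖z i‖ ^ p.toReal ≤ C ^ p.toReal := by
  rw [← norm_toLp_rpow, Real.rpow_le_rpow_iff (norm_nonneg _) hC (toReal_pos_of_fact p)]

theorem norm_toLp_le_one_iff {z : ι → ℂ} :
    ‖WithLp.toLp p z‖ ≤ 1 ↔ ∑ i, ‖z i‖ ^ p.toReal ≤ 1 := by
  rw [norm_toLp_le_iff p zero_le_one, Real.one_rpow]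

end PiLp

/-! ### Weakly summing families in the bidual -/

section Biduality

/-- On a finite-dimensional space finitely many functionals of norm at most `1` recover the norm
up to the factor `2`, by compactness of the unit sphere. -/
theorem exists_finite_norming_set (Z : Type*) [NormedAddCommGroup Z] [NormedSpace ℂ Z]
    [FiniteDimensional ℂ Z] :
    ∃ D : Finset (StrongDual ℂ Z), (∀ d ∈ D, ‖d‖ ≤ 1) ∧
      ∀ (z : Z) (B : ℝ), 0 ≤ B → (∀ d ∈ D, ‖d z‖ ≤ B) → ‖z‖ ≤ 2 * B := by
  have : ProperSpace Z := FiniteDimensional.proper ℂ Z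
  choose d hd hdz using fun z : Z => exists_dual_vector'' ℂ z
  obtain ⟨t, ht⟩ := (isCompact_sphere (0 : Z) 1).elim_finite_subcover
    (fun z : Z => {w : Z | 1 / 2 < ‖d z w‖})
    (fun z => isOpen_lt continuous_const (d z).continuous.norm)
    (fun z hz => Set.mem_iUnion.2 ⟨z, by
      have : ‖z‖ = 1 := by simpa using hz
      simp only [Set.mem_ofPred_eq, hdz, this]
      norm_num⟩)
  classical
  refine ⟨t.image d, fun f hf => ?_, fun z B hB h => ?_⟩
  · obtain ⟨z, -, rfl⟩ := Finset.mem_image.1 hf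
    exact hd z
  · by_cases hz : z = 0
    · rw [hz, norm_zero]
      positivity
    have hz0 : 0 < ‖z‖ := norm_pos_iff.2 hz
    have hmem : ((‖z‖⁻¹ : ℝ) : ℂ) • z ∈ Metric.sphere (0 : Z) 1 := by
      simp [norm_smul, hz]
    obtain ⟨w, hw, hwz⟩ := Set.mem_iUnion₂.1 (ht hmem)
    have h1 := h (d w) (Finset.mem_image_of_mem d hw)
    simp only [Set.mem_ofPred_eq, map_smul, norm_smul, Complex.norm_real, norm_inv,
      norm_norm] at hwz
    rw [← div_eq_inv_mul, lt_div_iff₀ hz0] at hwz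
    linarith

/-- The Hahn–Banach theorem for a functional given on the domain of a linear map `j` and dominated
by `‖j ·‖`. -/
theorem exists_dual_comp_eq {Y W : Type*} [AddCommGroup Y] [Module ℂ Y] [NormedAddCommGroup W]
    [NormedSpace ℂ W] (j : Y →ₗ[ℂ] W) (Ψ : Y →ₗ[ℂ] ℂ) {C : ℝ} (hC : 0 ≤ C)
    (h : ∀ y, ‖Ψ y‖ ≤ C * ‖j y‖) :
    ∃ Ξ : StrongDual ℂ W, ‖Ξ‖ ≤ C ∧ ∀ y, Ξ (j y) = Ψ y := by
  have hmem : Ψ ∈ LinearMap.range j.dualMap := by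
    rw [LinearMap.range_dualMap_eq_dualAnnihilator_ker, Submodule.mem_dualAnnihilator]
    intro y hy
    have := h y
    rw [LinearMap.mem_ker.1 hy, norm_zero, mul_zero] at this
    exact norm_le_zero_iff.1 this
  obtain ⟨Ξ₀, hΞ₀⟩ := hmem
  have hval : ∀ y, Ξ₀ (j y) = Ψ y := fun y => DFunLike.congr_fun hΞ₀ y
  obtain ⟨Ξ, hΞ, hΞn⟩ := exists_extension_norm_eq (LinearMap.range j)
    ((Ξ₀.domRestrict (LinearMap.range j)).mkContinuous C (by
      rintro ⟨_, y, rfl⟩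
      simpa [hval] using h y))
  refine ⟨Ξ, hΞn.trans_le (LinearMap.mkContinuous_norm_le _ hC _), fun y => ?_⟩
  rw [← hval]
  exact hΞ ⟨j y, y, rfl⟩

/-- The dual of a finite product with the maximum norm carries the sum of the norms. -/
theorem sum_norm_comp_single_le {ι X : Type*} [Fintype ι] [DecidableEq ι] [NormedAddCommGroup X]
    [NormedSpace ℂ X] (Ξ : StrongDual ℂ (ι → X)) :
    ∑ i, ‖Ξ ∘L ContinuousLinearMap.single ℂ (fun _ : ι => X) i‖ ≤ ‖Ξ‖ := by
  refine le_of_forall_pos_le_add fun δ hδ => ?_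
  set ξ : ι → StrongDual ℂ X := fun i => Ξ ∘L ContinuousLinearMap.single ℂ (fun _ : ι => X) i
  set η := δ / (Fintype.card ι + 1) with hη
  have hη0 : 0 < η := by positivity
  have hx : ∀ i, ∃ x : X, ‖x‖ ≤ 1 ∧ ∃ r : ℝ, ξ i x = r ∧ ‖ξ i‖ - η ≤ r := by
    intro i
    by_cases h0 : ‖ξ i‖ - η ≤ 0
    · exact ⟨0, by simp, 0, by simp, h0⟩
    · obtain ⟨x, hx1, hx⟩ := (ξ i).exists_lt_apply_of_lt_opNorm (r := ‖ξ i‖ - η) (by linarith)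
      have hne : (‖ξ i x‖ : ℂ) ≠ 0 := by
        exact_mod_cast (by linarith : (0 : ℝ) < ‖ξ i x‖).ne'
      refine ⟨(starRingEnd ℂ (ξ i x) / ‖ξ i x‖) • x, ?_, ‖ξ i x‖, ?_, hx.le⟩
      · rw [norm_smul, norm_div, RCLike.norm_conj, Complex.norm_real, norm_norm,
          div_self (by exact_mod_cast hne), one_mul]
        exact hx1.le
      · rw [map_smul, smul_eq_mul, div_mul_eq_mul_div, div_eq_iff hne, mul_comm,
          Complex.mul_conj, Complex.normSq_eq_norm_sq]
        push_cast
        ring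
  choose x hx1 r hxr hr using hx
  have e : Ξ x = ((∑ i, r i : ℝ) : ℂ) := by
    have : x = ∑ i, ContinuousLinearMap.single ℂ (fun _ : ι => X) i (x i) := by
      ext j
      simp [Finset.sum_apply, Pi.single_apply]
    rw [this, map_sum]
    push_cast
    exact Finset.sum_congr rfl fun i _ => hxr i
  have h1 : ∑ i, r i ≤ ‖Ξ‖ := by
    have h2 := Ξ.le_opNorm x
    rw [e, Complex.norm_real] at h2
    exact (le_abs_self _).trans (h2.trans (mul_le_of_le_one_right (norm_nonneg _)
      ((pi_norm_le_iff_of_nonneg zero_le_one).2 hx1)))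
  have h3 : ∑ i, (‖ξ i‖ - η) ≤ ∑ i, r i := Finset.sum_le_sum fun i _ => hr i
  rw [Finset.sum_sub_distrib, Finset.sum_const, Finset.card_univ, nsmul_eq_mul] at h3
  have h4 : Fintype.card ι * η ≤ δ := by
    rw [hη, mul_div_assoc', div_le_iff₀ (by positivity)]
    nlinarith
  linarith

variable {X : Type*} [NormedAddCommGroup X] [NormedSpace ℂ X]

/-- A form of Goldstine's theorem for the weak `p`-summing norm: a bound on `(Λ₁(x₁), …, Λₙ(xₙ))`
for all weakly `p`-summing `n`-tuples `x` in `X` persists, up to the factor `2`, for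
weakly `p`-summing `n`-tuples in `X''`. -/
theorem sum_norm_bidual_apply_rpow_le (p : ℝ≥0∞) [Fact (1 ≤ p)] [Fact (p ≠ ∞)] {ι : Type*}
    [Fintype ι] {Λ : ι → StrongDual ℂ X} {C : ℝ} (hC : 0 ≤ C)
    (hΛ : ∀ x : ι → X, (∀ ξ : StrongDual ℂ X, ‖ξ‖ ≤ 1 → ∑ i, ‖ξ (x i)‖ ^ p.toReal ≤ 1) →
      ∑ i, ‖Λ i (x i)‖ ^ p.toReal ≤ C ^ p.toReal)
    {l : ι → StrongDual ℂ (StrongDual ℂ X)}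
    (hl : ∀ ξ : StrongDual ℂ X, ‖ξ‖ ≤ 1 → ∑ i, ‖l i ξ‖ ^ p.toReal ≤ 1) :
    ∑ i, ‖l i (Λ i)‖ ^ p.toReal ≤ (2 * C) ^ p.toReal := by
  classical
  rw [← norm_toLp_le_iff p (by positivity)]
  obtain ⟨θ, hθ, hθz⟩ := exists_dual_vector'' ℂ (WithLp.toLp p fun i => l i (Λ i))
  obtain ⟨D, hD1, hD⟩ := exists_finite_norming_set (PiLp p fun _ : ι => ℂ)
  set e : ι → PiLp p fun _ : ι => ℂ := fun i => WithLp.toLp p (Pi.single i 1) with he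
  -- `j x` collects the combinations `∑ i, d(eᵢ) xᵢ`, whose norms control the weak norm of `x`; the
  -- functional `x ↦ ∑ i, θ(eᵢ) Λᵢ(xᵢ)` therefore factors through `j`, so that the `θ(eᵢ) Λᵢ` are
  -- combinations `∑ d, d(eᵢ) ξ_d` of finitely many `ξ_d`, with the same `ξ_d` for all `i`
  set j : (ι → X) →ₗ[ℂ] (D → X) :=
    LinearMap.pi fun d => ∑ i, (d : StrongDual ℂ (PiLp p fun _ : ι => ℂ)) (e i) •
      LinearMap.proj i with hj
  have hjd : ∀ x d, j x d = ∑ i, (d : StrongDual ℂ (PiLp p fun _ : ι => ℂ)) (e i) • x i := by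
    intro x d
    simp [hj]
  set Ψ : (ι → X) →ₗ[ℂ] ℂ :=
    ∑ i, θ (e i) • (Λ i : X →ₗ[ℂ] ℂ) ∘ₗ LinearMap.proj i with hΨ
  have hΨx : ∀ x, Ψ x = θ (WithLp.toLp p fun i => Λ i (x i)) := by
    intro x
    rw [dual_toLp_apply]
    simp [hΨ, he]
  have hweak : ∀ (x : ι → X) (ξ : StrongDual ℂ X), ‖ξ‖ ≤ 1 →
      ‖WithLp.toLp p fun i => ξ (x i)‖ ≤ 2 * ‖j x‖ := by
    intro x ξ hξ
    refine hD _ _ (norm_nonneg _) fun d hd => ?_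
    have : d (WithLp.toLp p fun i => ξ (x i)) = ξ (j x ⟨d, hd⟩) := by
      rw [dual_toLp_apply, hjd, map_sum]
      simp only [map_smul, smul_eq_mul]
      rfl
    rw [this]
    exact (ξ.le_opNorm _).trans ((mul_le_of_le_one_left (norm_nonneg _) hξ).trans
      (norm_le_pi_norm (j x) ⟨d, hd⟩))
  have hbound : ∀ (x : ι → X) (B : ℝ), 0 < B → 2 * ‖j x‖ ≤ B → ‖Ψ x‖ ≤ C * B := by
    intro x B hB hxB
    have h1 := hΛ (fun i => ((B⁻¹ : ℝ) : ℂ) • x i) fun ξ hξ => by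
      rw [← norm_toLp_le_one_iff]
      have : (WithLp.toLp p fun i => ξ (((B⁻¹ : ℝ) : ℂ) • x i)) =
          ((B⁻¹ : ℝ) : ℂ) • WithLp.toLp p fun i => ξ (x i) := by
        ext i
        simp
      rw [this, norm_smul, Complex.norm_real, Real.norm_of_nonneg (by positivity),
        ← div_eq_inv_mul, div_le_one hB]
      exact (hweak x ξ hξ).trans hxB
    rw [← norm_toLp_le_iff p hC] at h1
    have h2 : (WithLp.toLp p fun i => Λ i (((B⁻¹ : ℝ) : ℂ) • x i)) =
        ((B⁻¹ : ℝ) : ℂ) • WithLp.toLp p fun i => Λ i (x i) := by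
      ext i
      simp
    rw [h2, norm_smul, Complex.norm_real, Real.norm_of_nonneg (by positivity),
      ← div_eq_inv_mul, div_le_iff₀ hB] at h1
    rw [hΨx]
    exact ((θ.le_opNorm _).trans (mul_le_of_le_one_left (norm_nonneg _) hθ)).trans h1
  have hΨj : ∀ x, ‖Ψ x‖ ≤ 2 * C * ‖j x‖ := by
    intro x
    refine le_of_forall_pos_le_add fun δ hδ => ?_
    have h1 := hbound x (2 * ‖j x‖ + δ / (C + 1)) (by positivity) (by
      have : 0 ≤ δ / (C + 1) := by positivity
      linarith)
    have h2 : C * (δ / (C + 1)) ≤ δ := by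
      rw [mul_div_assoc', div_le_iff₀ (by positivity)]
      nlinarith
    nlinarith
  obtain ⟨Ξ, hΞ, hΞj⟩ := exists_dual_comp_eq j Ψ (by positivity : 0 ≤ 2 * C) hΨj
  set ξ : D → StrongDual ℂ X := fun d =>
    Ξ ∘L ContinuousLinearMap.single ℂ (fun _ : D => X) d with hξ
  have hdecomp : ∀ i, θ (e i) • Λ i =
      ∑ d : D, (d : StrongDual ℂ (PiLp p fun _ : ι => ℂ)) (e i) • ξ d := by
    intro i
    ext x
    have h1 : Ψ (Pi.single i x) = θ (e i) * Λ i x := by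
      simp only [hΨ, LinearMap.sum_apply, LinearMap.smul_apply, LinearMap.comp_apply,
        LinearMap.proj_apply, smul_eq_mul]
      rw [Finset.sum_eq_single i (fun k _ hk => by simp [Pi.single_eq_of_ne hk]) (by simp)]
      simp
    have h2 : j (Pi.single i x) = ∑ d : D, ContinuousLinearMap.single ℂ (fun _ : D => X) d
        ((d : StrongDual ℂ (PiLp p fun _ : ι => ℂ)) (e i) • x) := by
      ext d
      rw [hjd, Finset.sum_eq_single i (fun k _ hk => by simp [Pi.single_eq_of_ne hk]) (by simp)]
      simp [Finset.sum_apply, Pi.single_apply]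
    have h3 := hΞj (Pi.single i x)
    rw [h1, h2, map_sum] at h3
    rw [smul_apply, smul_eq_mul, ← h3, sum_apply]
    refine Finset.sum_congr rfl fun d _ => ?_
    rw [map_smul, map_smul]
    rfl
  have hfin : (‖WithLp.toLp p fun i => l i (Λ i)‖ : ℂ) =
      ∑ d : D, (d : StrongDual ℂ (PiLp p fun _ : ι => ℂ)) (WithLp.toLp p fun i => l i (ξ d)) := by
    have h1 : ∀ i, θ (e i) * l i (Λ i) =
        ∑ d : D, (d : StrongDual ℂ (PiLp p fun _ : ι => ℂ)) (e i) * l i (ξ d) := by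
      intro i
      rw [← smul_eq_mul, ← map_smul, hdecomp, map_sum]
      simp only [map_smul, smul_eq_mul]
    have h2 := hθz
    rw [dual_toLp_apply] at h2
    refine h2.symm.trans ?_
    rw [Finset.sum_congr rfl fun (d : D) _ => dual_toLp_apply p d.1 _, Finset.sum_comm]
    exact Finset.sum_congr rfl fun i _ => h1 i
  have hlξ : ∀ d, ‖WithLp.toLp p fun i => l i (ξ d)‖ ≤ ‖ξ d‖ := by
    intro d
    by_cases h0 : ξ d = 0
    · have : (WithLp.toLp p fun i => l i (ξ d)) = 0 := by
        ext i
        simp [h0]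
      rw [this, norm_zero]
      exact norm_nonneg _
    have hpos : 0 < ‖ξ d‖ := norm_pos_iff.2 h0
    have h1 := hl (((‖ξ d‖⁻¹ : ℝ) : ℂ) • ξ d) (by
      rw [norm_smul, Complex.norm_real, norm_inv, norm_norm, inv_mul_cancel₀ hpos.ne'])
    rw [← norm_toLp_le_one_iff] at h1
    have h2 : (WithLp.toLp p fun i => l i (((‖ξ d‖⁻¹ : ℝ) : ℂ) • ξ d)) =
        ((‖ξ d‖⁻¹ : ℝ) : ℂ) • WithLp.toLp p fun i => l i (ξ d) := by
      ext i
      simp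
    rwa [h2, norm_smul, Complex.norm_real, norm_inv, norm_norm, ← div_eq_inv_mul,
      div_le_one hpos] at h1
  calc ‖WithLp.toLp p fun i => l i (Λ i)‖
      = ‖(‖WithLp.toLp p fun i => l i (Λ i)‖ : ℂ)‖ := by
        rw [Complex.norm_real, norm_norm]
    _ ≤ ∑ d : D, ‖ξ d‖ := by
        rw [hfin]
        refine (norm_sum_le _ _).trans (Finset.sum_le_sum fun d _ => ?_)
        exact ((d : StrongDual ℂ (PiLp p fun _ : ι => ℂ)).le_opNorm _).trans
          ((mul_le_of_le_one_left (norm_nonneg _) (hD1 d d.2)).trans (hlξ d))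
    _ ≤ ‖Ξ‖ := sum_norm_comp_single_le Ξ
    _ ≤ 2 * C := hΞ

end Biduality

/-! ### Shift-summable functionals -/

section Shift

variable {G : Type u} [Group G] [TopologicalSpace G] [IsTopologicalGroup G]

/-- The functional `M` on the bounded continuous functions satisfies
`∑ |M(φᵢ(sᵢ ·))|^q ≤ C^q` for all finite families of distinct `sᵢ` and all `φᵢ` with
`∑ |φᵢ|^q ≤ 1` pointwise. -/
def IsShiftSummable (q C : ℝ) (M : StrongDual ℂ (G →ᵇ ℂ)) : Prop :=
  ∀ (ι : Type u) [Fintype ι] (s : ι → G) (φ : ι → G →ᵇ ℂ), Function.Injective s →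
    (∀ t, ∑ i, ‖φ i t‖ ^ q ≤ 1) → ∑ i, ‖M (leftShift (s i) (φ i))‖ ^ q ≤ C ^ q

theorem exists_openNhds_pairwise_disjoint_smul [T2Space G] {ι : Type*} [Finite ι] {s : ι → G}
    (hs : Function.Injective s) :
    ∃ V : TopologicalSpace.OpenNhdsOf (1 : G),
      Pairwise fun i j => Disjoint (s i • (V : Set G)) (s j • (V : Set G)) := by
  obtain ⟨U, hU, hd⟩ := (Set.finite_range s).t2_separation
  refine ⟨⟨⟨⋂ i, (fun t => s i * t) ⁻¹' U (s i), isOpen_iInter_of_finite fun i =>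
    (hU (s i)).2.preimage (continuous_const_mul _)⟩,
    Set.mem_iInter.2 fun i => by simpa using (hU (s i)).1⟩, fun i j hij => ?_⟩
  refine (hd ⟨i, rfl⟩ ⟨j, rfl⟩ (hs.ne hij)).mono ?_ ?_ <;>
  · rintro _ ⟨t, ht, rfl⟩
    exact Set.mem_iInter.1 ht _

theorem IsShiftSummable.of_tendsto {q C : ℝ} (hq : 0 < q) {κ : Type*} {l : Filter κ} [l.NeBot]
    {M : κ → StrongDual ℂ (G →ᵇ ℂ)} {N : StrongDual ℂ (G →ᵇ ℂ)}
    (hN : ∀ φ, Tendsto (fun k => M k φ) l (𝓝 (N φ)))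
    (h : ∀ (ι : Type u) [Fintype ι] (s : ι → G) (φ : ι → G →ᵇ ℂ), Function.Injective s →
      (∀ t, ∑ i, ‖φ i t‖ ^ q ≤ 1) →
        ∀ᶠ k in l, ∑ i, ‖M k (leftShift (s i) (φ i))‖ ^ q ≤ C ^ q) :
    IsShiftSummable q C N := fun ι _ s φ hs hφ =>
  le_of_tendsto (tendsto_finsetSum _ fun i _ =>
    ((hN (leftShift (s i) (φ i))).norm).rpow_const (Or.inr hq.le)) (h ι s φ hs hφ)

/-- A shift-summable functional with value `1` at the constant function `1` can be replaced by one
of norm `1`: if the unit vectors `hₖ` norm `M` asymptotically, the functionals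
`φ ↦ M(hₖ φ) / M(hₖ)` have norm tending to `1`, and multiplication by `hₖ` does not affect
shift-summability because it can be moved into the `φᵢ`. -/
theorem IsShiftSummable.exists_norm_le_one {q C : ℝ} (hq : 0 < q) (hC : 0 ≤ C)
    {M : StrongDual ℂ (G →ᵇ ℂ)} (hM : IsShiftSummable q C M) (hM1 : M 1 = 1) :
    ∃ N : StrongDual ℂ (G →ᵇ ℂ), ‖N‖ ≤ 1 ∧ N 1 = 1 ∧ IsShiftSummable q (2 * C) N := by
  have hMn : 1 ≤ ‖M‖ := by
    have h := M.le_opNorm 1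
    rwa [hM1, norm_one, norm_one, mul_one] at h
  have hex : ∀ k : ℕ, ∃ h : G →ᵇ ℂ, ‖h‖ ≤ 1 ∧ ‖M‖ - 1 / ((k : ℝ) + 2) ≤ ‖M h‖ := by
    intro k
    have hk : (0 : ℝ) < 1 / ((k : ℝ) + 2) := by positivity
    obtain ⟨h, h1, h2⟩ := M.exists_lt_apply_of_lt_opNorm (sub_lt_self ‖M‖ hk)
    exact ⟨h, h1.le, h2.le⟩
  choose h hh1 hMh using hex
  have hhalf : ∀ k, 1 / 2 ≤ ‖M (h k)‖ := fun k => by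
    have : 1 / ((k : ℝ) + 2) ≤ 1 / 2 :=
      one_div_le_one_div_of_le two_pos (by linarith [(Nat.cast_nonneg k : (0 : ℝ) ≤ k)])
    linarith [hMh k]
  have hne : ∀ k, M (h k) ≠ 0 := fun k h0 => by
    have := hhalf k
    rw [h0, norm_zero] at this
    linarith
  have hlim : Tendsto (fun k => ‖M (h k)‖) atTop (𝓝 ‖M‖) := by
    refine tendsto_of_tendsto_of_tendsto_of_le_of_le (g := fun k : ℕ => ‖M‖ - 1 / ((k : ℝ) + 2))
      ?_ tendsto_const_nhds hMh fun k =>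
        (M.le_opNorm _).trans (mul_le_of_le_one_right (norm_nonneg _) (hh1 k))
    have h0 := (tendsto_one_div_add_atTop_nhds_zero_nat (𝕜 := ℝ)).comp (tendsto_add_atTop_nat 1)
    have h1 := (tendsto_const_nhds (x := ‖M‖)).sub h0
    rw [sub_zero] at h1
    refine h1.congr fun k => ?_
    simp only [Function.comp_apply]
    push_cast
    ring
  set P : ℕ → StrongDual ℂ (G →ᵇ ℂ) := fun k =>
    (M (h k))⁻¹ • M ∘L ContinuousLinearMap.mul ℂ (G →ᵇ ℂ) (h k) with hP
  have hPapp : ∀ k φ, P k φ = (M (h k))⁻¹ * M (h k * φ) := fun k φ => rfl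
  have hPn : ∀ k φ, ‖P k φ‖ ≤ ‖M (h k)‖⁻¹ * (‖M‖ * ‖φ‖) := by
    intro k φ
    rw [hPapp, norm_mul, norm_inv]
    refine mul_le_mul_of_nonneg_left ((M.le_opNorm _).trans ?_) (by positivity)
    refine mul_le_mul_of_nonneg_left ((norm_mul_le _ _).trans ?_) (norm_nonneg _)
    exact mul_le_of_le_one_left (norm_nonneg _) (hh1 k)
  have hinv : ∀ k, ‖M (h k)‖⁻¹ ≤ 2 := fun k => by
    rw [inv_le_comm₀ ((one_half_pos).trans_le (hhalf k)) two_pos, ← one_div]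
    exact hhalf k
  have hPb : ∀ k, ‖P k‖ ≤ 2 * ‖M‖ := fun k =>
    ContinuousLinearMap.opNorm_le_bound _ (by positivity) fun φ => by
      rw [mul_assoc]
      exact (hPn k φ).trans (mul_le_mul_of_nonneg_right (hinv k) (by positivity))
  obtain ⟨U, N, hU, -, hN⟩ := exists_ultrafilter_tendsto_of_norm_le (atTop : Filter ℕ) hPb
  refine ⟨N, ?_, ?_, IsShiftSummable.of_tendsto hq hN fun ι _ s φ hs hφ =>
    Eventually.of_forall fun k => ?_⟩
  · refine ContinuousLinearMap.opNorm_le_bound _ zero_le_one fun φ => ?_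
    refine le_of_tendsto_of_tendsto (hN φ).norm ?_ (Eventually.of_forall fun k => hPn k φ)
    have h1 := ((hlim.mono_left hU).inv₀ (by linarith)).mul_const (‖M‖ * ‖φ‖)
    rwa [← mul_assoc, inv_mul_cancel₀ (by linarith)] at h1
  · refine tendsto_nhds_unique (hN 1) (tendsto_const_nhds.congr fun k => ?_)
    rw [hPapp, mul_one, inv_mul_cancel₀ (hne k)]
  · have h1 := hM ι s (fun i => leftShift (s i)⁻¹ (h k) * φ i) hs fun t => by
      refine (Finset.sum_le_sum fun i _ => ?_).trans (hφ t)
      refine Real.rpow_le_rpow (norm_nonneg _) ?_ hq.le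
      rw [BoundedContinuousFunction.mul_apply, norm_mul]
      exact mul_le_of_le_one_left (norm_nonneg _)
        (((h k).norm_coe_le_norm _).trans (hh1 k))
    have h2 : ∀ i, leftShift (s i) (leftShift (s i)⁻¹ (h k) * φ i) =
        h k * leftShift (s i) (φ i) := by
      intro i
      ext t
      change h k ((s i)⁻¹ * (s i * t)) * φ i (s i * t) = h k t * φ i (s i * t)
      rw [inv_mul_cancel_left]
    simp only [h2] at h1
    simp only [hPapp, norm_mul, norm_inv]
    rw [Real.mul_rpow zero_le_two hC]
    calc ∑ i, (‖M (h k)‖⁻¹ * ‖M (h k * leftShift (s i) (φ i))‖) ^ q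
        ≤ ∑ i, 2 ^ q * ‖M (h k * leftShift (s i) (φ i))‖ ^ q := by
          refine Finset.sum_le_sum fun i _ => ?_
          rw [Real.mul_rpow (by positivity) (norm_nonneg _)]
          exact mul_le_mul_of_nonneg_right
            (Real.rpow_le_rpow (by positivity) (hinv k) hq.le) (by positivity)
      _ ≤ 2 ^ q * C ^ q := by
          rw [← Finset.mul_sum]
          exact mul_le_mul_of_nonneg_left h1 (by positivity)

/-- Shift-summability passes to families with repeated translations: the `φᵢ` that belong to the
same translation are merged into one function, by means of a functional on `ℓᵖ` that norms the
corresponding vector of values. -/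
theorem IsShiftSummable.sum_le {p : ℝ≥0∞} [Fact (1 ≤ p)] [Fact (p ≠ ∞)] {C : ℝ}
    {M : StrongDual ℂ (G →ᵇ ℂ)} (hM : IsShiftSummable p.toReal C M) {ι : Type*} [Fintype ι]
    (s : ι → G) (φ : ι → G →ᵇ ℂ) (hφ : ∀ t, ∑ i, ‖φ i t‖ ^ p.toReal ≤ 1) :
    ∑ i, ‖M (leftShift (s i) (φ i))‖ ^ p.toReal ≤ C ^ p.toReal := by
  classical
  have hp := toReal_pos_of_fact p
  have hsum : ∀ x : ι → ℂ, ∑ r : Set.range s, ‖WithLp.toLp p fun i =>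
      if s i = r then x i else 0‖ ^ p.toReal = ∑ i, ‖x i‖ ^ p.toReal := by
    intro x
    simp only [norm_toLp_rpow]
    rw [Finset.sum_comm]
    refine Finset.sum_congr rfl fun i _ => ?_
    rw [Finset.sum_eq_single (⟨s i, i, rfl⟩ : Set.range s)]
    · simp
    · intro r _ hr
      rw [if_neg fun h => hr (Subtype.ext h.symm), norm_zero, Real.zero_rpow hp.ne']
    · simp
  choose θ hθ hθz using fun r : Set.range s => exists_dual_vector'' ℂ
    (WithLp.toLp p fun i => if s i = r then M (leftShift (s i) (φ i)) else 0)
  set e : ι → PiLp p fun _ : ι => ℂ := fun i => WithLp.toLp p (Pi.single i 1) with he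
  set ψ : Set.range s → G →ᵇ ℂ := fun r =>
    ∑ i, θ r (e i) • (if s i = r then φ i else 0) with hψ
  have hψt : ∀ r t, ψ r t = θ r (WithLp.toLp p fun i => if s i = r then φ i t else 0) := by
    intro r t
    rw [dual_toLp_apply, hψ, BoundedContinuousFunction.sum_apply]
    refine Finset.sum_congr rfl fun i _ => ?_
    split_ifs <;> simp [he]
  have hMψ : ∀ r : Set.range s, M (leftShift r (ψ r)) =
      ‖WithLp.toLp p fun i => if s i = r then M (leftShift (s i) (φ i)) else 0‖ := by
    intro r
    refine Eq.trans ?_ (hθz r)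
    have h1 : leftShift (r : G) (ψ r) =
        ∑ i, θ r (e i) • (if s i = r then leftShift (s i) (φ i) else 0) := by
      ext t
      rw [leftShift_apply, hψ, BoundedContinuousFunction.sum_apply,
        BoundedContinuousFunction.sum_apply]
      refine Finset.sum_congr rfl fun i _ => ?_
      split_ifs with h
      · rw [← h]
        rfl
      · rfl
    rw [dual_toLp_apply, h1, map_sum]
    refine Finset.sum_congr rfl fun i _ => ?_
    split_ifs <;> simp [he]
  have h1 := hM (Set.range s) Subtype.val ψ Subtype.val_injective fun t => by
    refine le_trans (Finset.sum_le_sum fun r _ => ?_) ((hsum fun i => φ i t).trans_le (hφ t))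
    refine Real.rpow_le_rpow (norm_nonneg _) ?_ hp.le
    rw [hψt]
    exact ((θ r).le_opNorm _).trans (mul_le_of_le_one_left (norm_nonneg _) (hθ r))
  simp only [hMψ, Complex.norm_real, norm_norm] at h1
  rwa [hsum fun i => M (leftShift (s i) (φ i))] at h1

end Shift

/-! ### From bounded continuous functions to `L¹(G)''` -/

section Mean

variable {G : Type u} [Group G] [TopologicalSpace G] [IsTopologicalGroup G] [LocallyCompactSpace G]
  [MeasurableSpace G] [BorelSpace G] (μ : Measure G) [μ.IsHaarMeasure] [μ.Regular]

/-- Along `V → 1` the functionals attached to the neighbourhoods `V` have a weak-star limit. For any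
finite set of distinct `sᵢ` the translates `sᵢ V` are disjoint once `V` is small, so the limit is
shift-summable. -/
theorem exists_norm_le_one_isShiftSummable_of_isInjective [T2Space G] (p : ℝ≥0∞) [Fact (1 ≤ p)]
    [Fact (p ≠ ∞)] (hinj : IsInjectiveBanachModule (Lp ℂ 1 μ) (Lp ℂ p μ)) :
    ∃ (C : ℝ) (M : StrongDual ℂ (G →ᵇ ℂ)), 0 ≤ C ∧ ‖M‖ ≤ 1 ∧ M 1 = 1 ∧
      IsShiftSummable p.toReal C M := by
  have hp := toReal_pos_of_fact p
  obtain ⟨R, hR, hRg⟩ := exists_retraction_of_isInjective μ p hinj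
  choose M hMn hM1 hM using fun V : (TopologicalSpace.OpenNhdsOf (1 : G))ᵒᵈ =>
    exists_functional_of_disjoint_translates μ p hR hRg
      (OrderDual.ofDual V).isOpen (OrderDual.ofDual V).mem
  obtain ⟨U, N, hU, -, hN⟩ := exists_ultrafilter_tendsto_of_norm_le atTop hMn
  have hNs : IsShiftSummable p.toReal ‖R‖ N := by
    refine IsShiftSummable.of_tendsto hp hN fun ι _ s φ hs hφ => hU ?_
    obtain ⟨V, hV⟩ := exists_openNhds_pairwise_disjoint_smul hs
    filter_upwards [eventually_ge_atTop (OrderDual.toDual V)] with W hW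
    have hWV : ((OrderDual.ofDual W : TopologicalSpace.OpenNhdsOf (1 : G)) : Set G) ⊆ V := hW
    exact hM W ι s φ (fun i j hij =>
      (hV hij).mono (Set.smul_set_mono hWV) (Set.smul_set_mono hWV)) hφ
  have hN1 : N 1 = 1 :=
    tendsto_nhds_unique (hN 1) (tendsto_const_nhds.congr fun V => (hM1 V).symm)
  obtain ⟨N', h1, h2, h3⟩ := hNs.exists_norm_le_one hp (norm_nonneg R) hN1
  exact ⟨2 * ‖R‖, N', by positivity, h1, h2, h3⟩

/-- The functions `t ↦ ⟨t · e, x⟩` for `x ∈ L¹(G)'`, where `e ∈ L¹(G)` is fixed: a bounded linear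
map from `L¹(G)'` into the bounded continuous functions, which commutes with translations. -/
def coefficientMap (e : Lp ℂ 1 μ) : StrongDual ℂ (Lp ℂ 1 μ) →L[ℂ] (G →ᵇ ℂ) :=
  LinearMap.mkContinuous
    { toFun := fun x => BoundedContinuousFunction.ofNormedAddCommGroup
        (fun t => x (leftTranslation μ 1 t e))
        (x.continuous.comp (continuous_leftTranslation μ 1 e)) (‖e‖ * ‖x‖)
        (fun t => (x.le_opNorm _).trans_eq (by rw [norm_leftTranslation, mul_comm]))
      map_add' := fun x y => by ext1 t; rfl
      map_smul' := fun c x => by ext1 t; rfl }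
    ‖e‖
    (fun x => (BoundedContinuousFunction.norm_le (by positivity)).2 fun t =>
      (x.le_opNorm _).trans_eq (by rw [norm_leftTranslation, mul_comm]))

theorem coefficientMap_apply (e : Lp ℂ 1 μ) (x : StrongDual ℂ (Lp ℂ 1 μ)) (t : G) :
    coefficientMap μ e x t = x (leftTranslation μ 1 t e) := rfl

theorem norm_coefficientMap_le (e : Lp ℂ 1 μ) : ‖coefficientMap μ e‖ ≤ ‖e‖ :=
  LinearMap.mkContinuous_norm_le _ (norm_nonneg e) _

theorem coefficientMap_comp_leftTranslation (e : Lp ℂ 1 μ) (x : StrongDual ℂ (Lp ℂ 1 μ)) (s : G) :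
    coefficientMap μ e (x ∘L leftTranslation μ 1 s) = leftShift s (coefficientMap μ e x) := by
  ext t
  rw [leftShift_apply, coefficientMap_apply, coefficientMap_apply, leftTranslation_mul]
  rfl

theorem constOneFunctional_apply (f : Lp ℂ 1 μ) : constOneFunctional μ f = ∫ t, f t ∂μ := rfl

theorem constOneFunctional_leftTranslation (s : G) (f : Lp ℂ 1 μ) :
    constOneFunctional μ (leftTranslation μ 1 s f) = constOneFunctional μ f := by
  rw [constOneFunctional_apply, constOneFunctional_apply,
    integral_congr_ae (leftTranslation_ae μ 1 s f), integral_mul_left_eq_self (fun t => f t)]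

theorem exists_norm_le_one_constOneFunctional_eq_one :
    ∃ e : Lp ℂ 1 μ, ‖e‖ ≤ 1 ∧ constOneFunctional μ e = 1 := by
  obtain ⟨K, hK, hK1⟩ := exists_compact_mem_nhds (1 : G)
  obtain ⟨W, hWsub, hW, hW1⟩ := mem_nhds_iff.1 hK1
  have hWfin : μ W ≠ ∞ := ((measure_mono hWsub).trans_lt hK.measure_lt_top).ne
  have hWpos : 0 < μ.real W := by
    rw [measureReal_def]
    exact ENNReal.toReal_pos (hW.measure_pos μ ⟨1, hW1⟩).ne' hWfin
  refine ⟨indicatorConstLp 1 hW.measurableSet hWfin (((μ.real W)⁻¹ : ℝ) : ℂ), ?_, ?_⟩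
  · rw [norm_indicatorConstLp one_ne_zero ENNReal.one_ne_top, Complex.norm_real,
      Real.norm_of_nonneg (by positivity)]
    simp [hWpos.ne']
  · rw [constOneFunctional_apply, integral_congr_ae indicatorConstLp_coeFn,
      integral_indicator_const _ hW.measurableSet, Complex.real_smul, ← Complex.ofReal_mul,
      mul_inv_cancel₀ hWpos.ne', Complex.ofReal_one]

theorem norm_constOneFunctional_le : ‖constOneFunctional μ‖ ≤ 1 :=
  LinearMap.mkContinuous_norm_le _ zero_le_one _

end Mean

/-! ### The weak multi-norm -/

section MultiNorm

variable {E : Type*} [NormedAddCommGroup E] [NormedSpace ℂ E]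

theorem sum_rpow_le_one_of_weakSummingNorm_le_one {q : ℝ} (hq : 0 < q) {n : ℕ} {x : Fin n → E}
    (h : weakSummingNorm q x ≤ 1) {φ : StrongDual ℂ E} (hφ : ‖φ‖ ≤ 1) :
    ∑ i, ‖φ (x i)‖ ^ q ≤ 1 := by
  have h1 : (∑ i, ‖φ (x i)‖ₑ ^ q) ^ (1 / q) ≤ 1 :=
    (le_iSup₂ (f := fun (φ : StrongDual ℂ E) (_ : ‖φ‖ ≤ 1) =>
      (∑ i, ‖φ (x i)‖ₑ ^ q) ^ (1 / q)) φ hφ).trans h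
  have h2 := ENNReal.rpow_le_rpow h1 hq.le
  rw [← ENNReal.rpow_mul, one_div, inv_mul_cancel₀ hq.ne', ENNReal.rpow_one,
    ENNReal.one_rpow] at h2
  simp only [← ofReal_norm, ENNReal.ofReal_rpow_of_nonneg (norm_nonneg _) hq.le] at h2
  rw [← ENNReal.ofReal_sum_of_nonneg fun i _ => by positivity] at h2
  exact ENNReal.ofReal_le_one.1 h2

theorem isWeakMultiBounded_of_forall_sum_le {q C : ℝ} (hq : 0 < q) (hC : 0 ≤ C) {B : Set E}
    (h : ∀ (n : ℕ) (x : Fin n → E), (∀ i, x i ∈ B) → ∀ φ : Fin n → StrongDual ℂ E,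
      (∀ ξ : StrongDual ℂ (StrongDual ℂ E), ‖ξ‖ ≤ 1 → ∑ i, ‖ξ (φ i)‖ ^ q ≤ 1) →
        ∑ i, ‖φ i (x i)‖ ^ q ≤ C ^ q) :
    IsWeakMultiBounded q q B := by
  refine lt_of_le_of_lt (iSup_le fun n => iSup_le fun x => iSup_le fun hx => ?_)
    (ENNReal.ofReal_lt_top (r := C))
  refine iSup_le fun φ => iSup_le fun hφ => ?_
  have h1 := h n x hx φ fun ξ hξ => sum_rpow_le_one_of_weakSummingNorm_le_one hq hφ hξ
  have h2 : ∑ i, ‖φ i (x i)‖ₑ ^ q ≤ ENNReal.ofReal C ^ q := by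
    simp only [← ofReal_norm, ENNReal.ofReal_rpow_of_nonneg (norm_nonneg _) hq.le]
    rw [ENNReal.ofReal_rpow_of_nonneg hC hq.le,
      ← ENNReal.ofReal_sum_of_nonneg fun i _ => by positivity]
    exact ENNReal.ofReal_le_ofReal h1
  refine (ENNReal.rpow_le_rpow h2 (by positivity)).trans_eq ?_
  rw [← ENNReal.rpow_mul, mul_one_div_cancel hq.ne', ENNReal.rpow_one]

end MultiNorm

end

theorem theorem5p3p7 {G : Type*} [Group G] [TopologicalSpace G] [IsTopologicalGroup G]
    [LocallyCompactSpace G] [T2Space G] [MeasurableSpace G] [BorelSpace G]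
    (μ : Measure G) [μ.IsHaarMeasure] [μ.Regular]
    (p : ℝ≥0∞) [Fact (1 ≤ p)] [Fact (p ≠ ∞)] (hp : 1 < p)
    (hinj : IsInjectiveBanachModule (Lp ℂ 1 μ) (Lp ℂ p μ)) :
    IsMultiAmenable μ p.toReal p.toReal := by
  have hp0 := toReal_pos_of_fact p
  obtain ⟨C, M, hC, hMn, hM1, hM⟩ := exists_norm_le_one_isShiftSummable_of_isInjective μ p hinj
  obtain ⟨e, he, he1⟩ := exists_norm_le_one_constOneFunctional_eq_one μ
  have hΛ1 : (M ∘L coefficientMap μ e) (constOneFunctional μ) = 1 := by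
    have : coefficientMap μ e (constOneFunctional μ) = 1 := by
      ext t
      rw [coefficientMap_apply, constOneFunctional_leftTranslation, he1]
      rfl
    rw [ContinuousLinearMap.comp_apply, this, hM1]
  refine ⟨M ∘L coefficientMap μ e, ⟨hΛ1, le_antisymm ?_ ?_⟩, ?_⟩
  · exact (ContinuousLinearMap.opNorm_comp_le _ _).trans (mul_le_one₀ hMn (norm_nonneg _)
      ((norm_coefficientMap_le μ e).trans he))
  · have h := (M ∘L coefficientMap μ e).le_opNorm (constOneFunctional μ)
    rw [hΛ1, norm_one] at h
    exact h.trans (mul_le_of_le_one_right (norm_nonneg _) (norm_constOneFunctional_le μ))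
  · refine isWeakMultiBounded_of_forall_sum_le (C := 2 * C) hp0 (by positivity)
      fun n Λ hΛ l hl => ?_
    choose s hs using hΛ
    refine sum_norm_bidual_apply_rpow_le p hC (fun x hx => ?_) fun ξ hξ => ?_
    -- for families in `L¹(G)'` the estimate is the shift-summability of `M`
    · have h1 : ∀ i, Λ i (x i) = M (leftShift (s i) (coefficientMap μ e (x i))) := by
        intro i
        rw [← hs i, ← coefficientMap_comp_leftTranslation]
        rfl
      simp only [h1]
      refine hM.sum_le s _ fun t => ?_
      -- evaluation at `t · e` is an element of the unit ball of `L¹(G)''`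
      refine hx (NormedSpace.inclusionInDoubleDual ℂ _ (leftTranslation μ 1 t e)) ?_
      refine (NormedSpace.double_dual_bound ℂ _ _).trans ?_
      rwa [norm_leftTranslation]
    -- the functionals on the third dual that test `l` include the elements of `L¹(G)''`
    · have h2 := hl (NormedSpace.inclusionInDoubleDual ℂ _ ξ)
        ((NormedSpace.double_dual_bound ℂ _ ξ).trans hξ)
      exact h2
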